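/- Let $k\in\mathbb C$ with $\operatorname{Im}k>0$, let $\theta_{\rm I}\in\mathbb R$, and let $H^{(1)}_0$ be the Hankel function. Consider $\mathcal J$ semi-infinite arrays in the plane; the $n$-th scatterer ($n\ge 0$) of the $j$-th array is at $\mathbf R^{(j)}_n=R^{(j)}_0(\cos\theta^{(j)}_0,\sin\theta^{(j)}_0)+n s_j(\cos\alpha_j,\sin\alpha_j)$ and has radius $a_j$, where $s_j>0$ and $0<a_j<s_j/2$. Put $\Lambda^{(j,\ell)}(m,n)=|\mathbf R^{(j)}_m-\mathbf R^{(\ell)}_n|$ and assume $a_j+a_\ell<\Lambda^{(j,\ell)}(m,n)$ for all $j\neq\ell$ and $m,n\ge0$. Let $\mathbf k=-k(\cos\theta_{\rm I},\sin\theta_{\rm I})$, $z_j=e^{iks_j\cos(\alpha_j-\theta_{\rm I})}$, $\Omega_j^+=\{|z|<e^{-\operatorname{Im}(k)s_j\cos(\alpha_j-\theta_{\rm I})}\}$, $\Omega_j^-=\{|z|>e^{-\operatorname{Im}(k)s_j}\}$ and assume $\Omega_j^+\cap\Omega_j^-\ne\emptyset$ for all $j$. On the annulus $\mathcal A_j=\{e^{-\operatorname{Im}(k)s_j}<|z|<e^{\operatorname{Im}(k)s_j}\}$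 let $$K_j(z)=H^{(1)}_0(ka_j)+\sum_{\ell=1}^\infty(z^\ell+z^{-\ell})H^{(1)}_0(ks_j\ell).$$ (1) For given $k$ and $s_j$, the kernel $K_j$ has no zero in $\mathcal A_j$ if $a_j$ is sufficiently small. (2) If $K_j$ has no zero in $\mathcal A_j$, then it has an analytic logarithm there, and the formulae $$\ln K_j^+(z)=\ln K_j^0-\frac1{2\pi i}\int_C\frac{\ln K_j(\xi)}{\xi-1/z}\,d\xi,\quad \ln K_j^-(z)=\ln K_j^0-\frac1{2\pi i}\int_C\frac{\ln K_j(\xi)}{\xi-z}\,d\xi,\quad \ln K_j^0=\ln K_j^+(0)=\frac1{4\pi i}\int_C\frac{\ln K_j(\xi)}{\xi}\,d\xi,$$ where $C$ is any anticlockwise circle about $0$ in $\mathcal A_j$ of radius less than $1/|z|$, respectively $|z|$, define $K_j^+$ on $\{|z|<e^{\operatorname{Im}(k)s_j}\}$ and $K_j^-$ on $\Omega_j^-$. These functions are analytic and zero-free, $K_j^-(1/z)=K_j^+(z)$ for $0<|z|<e^{\operatorname{Im}(k)s_j}$, and $K_j=K_j^+K_j^-$ on $\mathcal A_j$. (3)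 Suppose that every $K_j$ has no zero in $\mathcal A_j$. Let $\lambda_{j,n}=\frac1{n!}\frac{d^n}{dz^n}\big[1/K_j^+(z)\big]_{z=0}$ and $$A^{(j)}_{0,m}=-\frac{e^{i\mathbf k\cdot\mathbf R^{(j)}_0}}{K_j^-(z_j)}\sum_{n=0}^m\lambda_{j,n}z_j^{n-m},\qquad \mathcal M^{(j,\ell)}_{mq}=\sum_{p=0}^\infty\sum_{n=0}^m\lambda_{j,m-n}\lambda_{j,p}H^{(1)}_0\big(k\Lambda^{(j,\ell)}(p+n,q)\big)\quad(\ell\ne j).$$ Then $\sum_m A^{(j)}_{0,m}z^m$ converges in $\Omega_j^+$, and $(A^{(j)}_{0,m})_m$ solves the Foldy system (below, with $\mathcal J=1$) of the $j$-th array alone; the series for $\mathcal M^{(j,\ell)}_{mq}$ converge absolutely. Moreover, let $A^{(j)}_m$ ($1\le j\le\mathcal J$, $m\ge0$) be coefficients whose Z-transforms $\sum_m A^{(j)}_mz^m$ converge in $\Omega_j^+$ and that satisfy, for all $j$ and all $m\ge0$, the coupled Foldy systems $$A^{(j)}_mH^{(1)}_0(ka_j)+\sum_{n\ge0,\,n\ne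 m}A^{(j)}_nH^{(1)}_0(ks_j|m-n|)=-e^{i\mathbf k\cdot\mathbf R^{(j)}_m}-\sum_{\ell\ne j}\sum_{n=0}^\infty A^{(\ell)}_nH^{(1)}_0\big(k\Lambda^{(j,\ell)}(m,n)\big).$$ Then for all $j$ and $m$ $$A^{(j)}_m=A^{(j)}_{0,m}-\sum_{\ell\ne j}\sum_{q=0}^\infty\sum_{p=0}^\infty\sum_{n=0}^m\lambda_{j,m-n}\lambda_{j,p}A^{(\ell)}_qH^{(1)}_0\big(k\Lambda^{(j,\ell)}(p+n,q)\big),$$ where the double series in $(q,p)$ converges absolutely. Equivalently, $\mathbf A^{(j)}=\mathbf A^{(j)}_0-\sum_{\ell\neq j}\mathcal M^{(j,\ell)}\mathbf A^{(\ell)}$ for all $j$, that is, the block system with identity diagonal blocks and off-diagonal blocks $\mathcal M^{(j,\ell)}$ maps $(\mathbf A^{(\ell)})_\ell$ to $(\mathbf A^{(j)}_0)_j$; all these series converge absolutely. -/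

import Mathlib

open Complex

namespace FoldyArrays

noncomputable section

/-- The Hankel function `H₀⁽¹⁾` on the upper half plane, by its classical integral representation
`H₀⁽¹⁾(w) = (π i)⁻¹ ∫_{-∞}^{∞} exp (i w cosh t) dt`, valid for `0 < Im w`. It is only ever evaluated
at `w = k x` with `0 < Im k` and `0 < x`. -/
def hankel (w : ℂ) : ℂ :=
  (Real.pi * I)⁻¹ * ∫ t : ℝ, exp (I * w * (Real.cosh t : ℂ))

/-- The parameters of a semi-infinite array: scatterer radius `a`, spacing `s`, angle `α` with the
`x`-axis, and polar coordinates `(R₀, θ₀)` of the first scatterer. -/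
structure SemiInfiniteArray where
  a : ℝ
  s : ℝ
  α : ℝ
  R₀ : ℝ
  θ₀ : ℝ

/-- Position of the `n`-th scatterer of an array. -/
def SemiInfiniteArray.pos (X : SemiInfiniteArray) (n : ℕ) : EuclideanSpace ℝ (Fin 2) :=
  !₂[X.R₀ * Real.cos X.θ₀ + n * X.s * Real.cos X.α,
     X.R₀ * Real.sin X.θ₀ + n * X.s * Real.sin X.α]

/-- The distance between the `m`-th scatterer of `X` and the `n`-th scatterer of `Y`. -/
def scattererDist (X Y : SemiInfiniteArray) (m n : ℕ) : ℝ :=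
  dist (X.pos m) (Y.pos n)

/-- The scatterers have positive radius and do not overlap. -/
structure Admissible {J : ℕ} (X : Fin J → SemiInfiniteArray) : Prop where
  radius_pos : ∀ j, 0 < (X j).a
  spacing_pos : ∀ j, 0 < (X j).s
  same_array : ∀ j, (X j).a < (X j).s / 2
  other_array : ∀ j l, j ≠ l → ∀ m n, (X j).a + (X l).a < scattererDist (X j) (X l) m n

/-- The incident plane wave `exp (i 𝐤 · r)`, with wavevector
`𝐤 = -k (cos θI, sin θI)`. -/
def incident (k : ℂ) (θI : ℝ) (r : EuclideanSpace ℝ (Fin 2)) : ℂ :=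
  exp (I * (-k * ((Real.cos θI * r 0 + Real.sin θI * r 1 : ℝ) : ℂ)))

/-- The coupled systems of Foldy equations for the scattering coefficients `A j m`. -/
def IsFoldySolution {J : ℕ} (k : ℂ) (θI : ℝ) (X : Fin J → SemiInfiniteArray)
    (A : Fin J → ℕ → ℂ) : Prop :=
  ∀ (j : Fin J) (m : ℕ),
    A j m * hankel (k * (X j).a)
      + ∑' n : ℕ, (if n = m then 0
          else A j n * hankel (k * ((X j).s * |(m : ℝ) - (n : ℝ)| : ℝ)))
    = - incident k θI ((X j).pos m)
      - ∑ l ∈ Finset.univ.erase j,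
          ∑' n : ℕ, A l n * hankel (k * scattererDist (X j) (X l) m n)

/-- The region `Ω⁺`. -/
def OmegaPlus (k : ℂ) (θI : ℝ) (X : SemiInfiniteArray) : Set ℂ :=
  {z | ‖z‖ < Real.exp (-(k.im * X.s * Real.cos (X.α - θI)))}

/-- The region `Ω⁻`; it depends on the array only through the spacing `s`. -/
def OmegaMinus (k : ℂ) (s : ℝ) : Set ℂ :=
  {z | Real.exp (-(k.im * s)) < ‖z‖}

/-- The Z-transform `∑ₘ Aₘ zᵐ` converges in `Ω⁺`. -/
def ZTransformConverges (k : ℂ) (θI : ℝ) (X : SemiInfiniteArray) (A : ℕ → ℂ) : Prop :=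
  ∀ z ∈ OmegaPlus k θI X, Summable fun m : ℕ => A m * z ^ m

/-- The annulus of convergence of the Wiener–Hopf kernel. -/
def kernelAnnulus (k : ℂ) (s : ℝ) : Set ℂ :=
  {z | Real.exp (-(k.im * s)) < ‖z‖ ∧ ‖z‖ < Real.exp (k.im * s)}

/-- The Wiener–Hopf kernel
`K(z) = H₀⁽¹⁾(k a) + ∑_{l ≥ 1} (z ^ l + z ^ (-l)) H₀⁽¹⁾(k s l)`. -/
def kernel (k : ℂ) (a s : ℝ) (z : ℂ) : ℂ :=
  hankel (k * a)
    + ∑' l : ℕ, (z ^ (l + 1) + z⁻¹ ^ (l + 1)) * hankel (k * (s * (l + 1) : ℝ))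

/-- The kernel has no zero in its annulus. -/
def KernelZeroFree (k : ℂ) (a s : ℝ) : Prop :=
  ∀ z ∈ kernelAnnulus k s, kernel k a s z ≠ 0

/-- `L` is an analytic branch of `ln K` on the annulus. -/
def IsKernelLog (k : ℂ) (a s : ℝ) (L : ℂ → ℂ) : Prop :=
  DifferentiableOn ℂ L (kernelAnnulus k s) ∧
    ∀ z ∈ kernelAnnulus k s, exp (L z) = kernel k a s z

/-- `ln K⁰ = (4π i)⁻¹ ∮_{|ξ| = ρ} L(ξ) / ξ dξ`. -/
def logK0 (L : ℂ → ℂ) (ρ : ℝ) : ℂ :=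
  (4 * Real.pi * I)⁻¹ * ∮ ξ in C(0, ρ), L ξ / ξ

/-- `Kp = K⁺` and `Km = K⁻` are the factors of the kernel given by Cauchy's integral formulae
applied to a branch `L` of `ln K`, over anticlockwise circles in the annulus that run
radially below the pole (`ξ = 1 / z` for `K⁺`, `ξ = z` for `K⁻`). In the formula for `K⁺`,
`1 / (ξ - 1 / z)` is written as `z / (z ξ - 1)`, which also covers `K⁺(0) = K⁰`. -/
def IsKernelFactorization (k : ℂ) (a s : ℝ) (Kp Km : ℂ → ℂ) : Prop :=
  ∃ L : ℂ → ℂ, IsKernelLog k a s L ∧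
    ∀ ρ : ℝ, Real.exp (-(k.im * s)) < ρ → ρ < Real.exp (k.im * s) →
      (∀ z : ℂ, ρ * ‖z‖ < 1 →
        Kp z = exp (logK0 L ρ
          - (2 * Real.pi * I)⁻¹ * ∮ ξ in C(0, ρ), L ξ * (z / (z * ξ - 1)))) ∧
      (∀ z : ℂ, ρ < ‖z‖ →
        Km z = exp (logK0 L ρ
          - (2 * Real.pi * I)⁻¹ * ∮ ξ in C(0, ρ), L ξ / (ξ - z)))

/-- The Taylor coefficients `λₙ` of `1 / K⁺` at `0`. -/
def lam (Kp : ℂ → ℂ) (n : ℕ) : ℂ :=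
  iteratedDeriv n (fun z => (Kp z)⁻¹) 0 / (n.factorial : ℂ)

/-- The pole `exp (i k s cos (α - θI))` of the forcing term. -/
def pole (k : ℂ) (θI : ℝ) (X : SemiInfiniteArray) : ℂ :=
  exp (I * k * (X.s * Real.cos (X.α - θI) : ℝ))

/-- The coefficients `A₀,ₘ` of the solution for the array `X` alone. -/
def singleArray (k : ℂ) (θI : ℝ) (X : SemiInfiniteArray) (Kp Km : ℂ → ℂ) (m : ℕ) : ℂ :=
  - (incident k θI (X.pos 0) / Km (pole k θI X))
    * ∑ n ∈ Finset.range (m + 1), lam Kp n * pole k θI X ^ ((n : ℤ) - (m : ℤ))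

/-- The `p`-th term of the entry `(m, q)` of the interaction matrix. -/
def interactionTerm (k : ℂ) (X Y : SemiInfiniteArray) (Kp : ℂ → ℂ) (m q p : ℕ) : ℂ :=
  ∑ n ∈ Finset.range (m + 1),
    lam Kp (m - n) * lam Kp p * hankel (k * scattererDist X Y (p + n) q)

/-- The infinite interaction matrix, describing the action of the array `Y` on the array `X`;
`Kp` is the factor `K⁺` of the kernel of `X`. -/
def interactionMatrix (k : ℂ) (X Y : SemiInfiniteArray) (Kp : ℂ → ℂ) : Matrix ℕ ℕ ℂ :=
  fun m q => ∑' p : ℕ, interactionTerm k X Y Kp m q p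

/-- The block matrix with identity blocks on the diagonal and the interaction matrices
off the diagonal. -/
def blockMatrix {J : ℕ} (k : ℂ) (X : Fin J → SemiInfiniteArray) (Kp : Fin J → ℂ → ℂ) :
    Matrix (Fin J × ℕ) (Fin J × ℕ) ℂ :=
  fun u v =>
    if u.1 = v.1 then (1 : Matrix ℕ ℕ ℂ) u.2 v.2
    else interactionMatrix k (X u.1) (X v.1) (Kp u.1) u.2 v.2

end

end FoldyArrays

/-!
The integral representation makes `Re (π i H₀⁽¹⁾(k a))` blow up logarithmically as `a → 0`, while
the rest of the kernel is the integral of a geometric series whose real part is bounded below on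
the annulus, so the kernel of small scatterers has no zeros.

A zero-free kernel has winding number zero because `K(1/z) = K(z)`, hence a logarithm `L` with
`L(1/z) = L(z)`. Cauchy's formula over two circles splits `L(z)` as `l(z) + l(1/z)` with `l`
analytic on the large disc, which gives `K(z) = K⁺(z) K⁺(1/z)`.

In terms of coefficients, the operator of the Foldy system is a symmetric Toeplitz matrix which
factors as an upper times a lower triangular Toeplitz matrix, both with the Taylor coefficients of
`K⁺` as entries. The coefficients `λₙ` of `1 / K⁺` therefore invert it. The incident wave
restricts to a geometric sequence on each array, hence to an eigenvector of the upper triangular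
factor. Since `H₀⁽¹⁾` decays exponentially and the distances between scatterers of two arrays grow
linearly in either index, all the double series converge absolutely.
-/

namespace FoldyArrays

open MeasureTheory Set Metric

section Hankel

lemma sq_div_four_le_cosh (t : ℝ) : t ^ 2 / 4 ≤ Real.cosh t := by
  rw [← Real.cosh_abs, Real.cosh_eq, ← sq_abs]
  linarith [Real.quadratic_le_exp_of_nonneg (abs_nonneg t), Real.exp_pos (-|t|), abs_nonneg t]

lemma cosh_le_exp {t : ℝ} (ht : 0 ≤ t) : Real.cosh t ≤ Real.exp t := by
  linarith [Real.cosh_eq t, Real.exp_le_exp.2 (neg_le_self ht)]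

lemma integrable_exp_neg_mul_cosh {y : ℝ} (hy : 0 < y) :
    Integrable fun t : ℝ => Real.exp (-(y * Real.cosh t)) := by
  refine (integrable_exp_neg_mul_sq (b := y / 4) (by positivity)).mono' (by fun_prop)
    (.of_forall fun t => ?_)
  rw [Real.norm_eq_abs, Real.abs_exp, Real.exp_le_exp]
  nlinarith [sq_div_four_le_cosh t]

lemma norm_exp_I_mul_cosh (w : ℂ) (t : ℝ) :
    ‖exp (I * w * (Real.cosh t : ℂ))‖ = Real.exp (-(w.im * Real.cosh t)) := by
  simp [norm_exp]

lemma integrable_exp_I_mul_cosh {w : ℂ} (hw : 0 < w.im) :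
    Integrable fun t : ℝ => exp (I * w * (Real.cosh t : ℂ)) :=
  (integrable_exp_neg_mul_cosh hw).mono' (Continuous.aestronglyMeasurable (by fun_prop))
    (.of_forall fun t => (norm_exp_I_mul_cosh w t).le)

lemma integral_exp_neg_mul_cosh_le {y₀ y : ℝ} (hy₀ : 0 < y₀) (hy : y₀ ≤ y) :
    ∫ t : ℝ, Real.exp (-(y * Real.cosh t))
      ≤ (∫ t : ℝ, Real.exp (y₀ - y₀ * Real.cosh t)) * Real.exp (-y) := by
  simp only [← integral_mul_const, ← Real.exp_add]
  refine integral_mono (integrable_exp_neg_mul_cosh (hy₀.trans_le hy)) ?_ fun t => ?_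
  · refine ((integrable_exp_neg_mul_cosh hy₀).const_mul (Real.exp (y₀ - y))).congr
      (.of_forall fun t => ?_)
    simp only [← Real.exp_add]
    ring_nf
  · rw [Real.exp_le_exp]
    nlinarith [mul_nonneg (sub_nonneg.2 hy) (sub_nonneg.2 (Real.one_le_cosh t))]

theorem exists_norm_hankel_le {y₀ : ℝ} (hy₀ : 0 < y₀) :
    ∃ C, 0 ≤ C ∧ ∀ w : ℂ, y₀ ≤ w.im → ‖hankel w‖ ≤ C * Real.exp (-w.im) := by
  refine ⟨‖((Real.pi : ℂ) * I)⁻¹‖ * ∫ t : ℝ, Real.exp (y₀ - y₀ * Real.cosh t),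
    by positivity, fun w hw => ?_⟩
  rw [hankel, norm_mul, mul_assoc]
  gcongr
  refine (norm_integral_le_integral_norm _).trans ?_
  simpa only [norm_exp_I_mul_cosh] using integral_exp_neg_mul_cosh_le hy₀ hw

end Hankel

section SmallArgument

lemma exp_neg_one_mul_cos_one_le_re_exp {z : ℂ} (hz : ‖z‖ ≤ 1) :
    Real.exp (-1) * Real.cos 1 ≤ (exp z).re := by
  have hre : -1 ≤ z.re := (abs_le.1 ((abs_re_le_norm z).trans hz)).1
  have him : Real.cos 1 ≤ Real.cos z.im := by
    rw [← Real.cos_abs z.im]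
    exact Real.cos_le_cos_of_nonneg_of_le_pi (abs_nonneg _) (by linarith [Real.pi_gt_three])
      ((abs_im_le_norm z).trans hz)
  rw [exp_re]
  gcongr
  exact Real.cos_one_pos.le

lemma integral_Ioi_exp_neg_mul_cosh_le {y : ℝ} (hy : 0 < y) (T : ℝ) :
    ∫ t in Ioi T, Real.exp (-(y * Real.cosh t)) ≤ 2 * Real.exp (-T) / y := by
  set c := y * Real.exp T / 2 with hc
  have hc0 : 0 < c := by positivity
  have hle (t : ℝ) : Real.exp (-(y * Real.cosh t)) ≤ Real.exp (c * T) * Real.exp (-c * t) := by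
    have hexp : Real.exp T * Real.exp (t - T) = Real.exp t := by rw [← Real.exp_add]; ring_nf
    have hcosh : Real.exp T * (t - T) / 2 ≤ Real.cosh t := by
      rw [Real.cosh_eq]
      nlinarith [Real.add_one_le_exp (t - T), Real.exp_pos T, Real.exp_pos (-t)]
    rw [← Real.exp_add, Real.exp_le_exp, hc]
    linarith [mul_le_mul_of_nonneg_left hcosh hy.le]
  calc ∫ t in Ioi T, Real.exp (-(y * Real.cosh t))
      ≤ ∫ t in Ioi T, Real.exp (c * T) * Real.exp (-c * t) :=
        setIntegral_mono (integrable_exp_neg_mul_cosh hy).integrableOn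
          ((integrableOn_exp_mul_Ioi (neg_neg_of_pos hc0) T).const_mul _) hle
    _ = 2 * Real.exp (-T) / y := by
        rw [integral_const_mul, integral_exp_mul_Ioi (neg_neg_of_pos hc0), neg_div_neg_eq,
          ← mul_div_assoc, ← Real.exp_add, hc, Real.exp_neg]
        simp only [neg_mul, add_neg_cancel, Real.exp_zero]
        field_simp

/-- As `w → 0` with `‖w‖ / Im w` fixed, the lower bound grows like `-log ‖w‖`: on `[0, -log ‖w‖]`
the exponent `i w cosh t` stays in the unit disc, and the rest of the integral is bounded. -/
lemma le_re_integral_exp_I_mul_cosh {w : ℂ} (hw : 0 < w.im) (hw1 : ‖w‖ ≤ 1) :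
    2 * (Real.exp (-1) * Real.cos 1 * -Real.log ‖w‖ - 2 * ‖w‖ / w.im)
      ≤ (∫ t : ℝ, exp (I * w * (Real.cosh t : ℂ))).re := by
  have hw0 : 0 < ‖w‖ := hw.trans_le ((le_abs_self _).trans (abs_im_le_norm w))
  set T := -Real.log ‖w‖ with hT
  have hT0 : 0 ≤ T := neg_nonneg.2 (Real.log_nonpos hw0.le hw1)
  have hexpT : Real.exp T = ‖w‖⁻¹ := by rw [hT, Real.exp_neg, Real.exp_log hw0]
  set f : ℝ → ℝ := fun t => (exp (I * w * (Real.cosh t : ℂ))).re with hf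
  have hint : Integrable f := (integrable_exp_I_mul_cosh hw).re
  have habs : (∫ t : ℝ, exp (I * w * (Real.cosh t : ℂ))).re = ∫ t : ℝ, f |t| := by
    simp only [hf, Real.cosh_abs]
    exact (integral_re (integrable_exp_I_mul_cosh hw)).symm
  have hnear : Real.exp (-1) * Real.cos 1 * T ≤ ∫ t in Ioc 0 T, f t := by
    have hconst : ∫ _ in Ioc 0 T, Real.exp (-1) * Real.cos 1 = Real.exp (-1) * Real.cos 1 * T := by
      simp [hT0, mul_comm]
    rw [← hconst]
    refine setIntegral_mono_on (integrableOn_const (by simp)) hint.integrableOn measurableSet_Ioc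
      fun t ht => exp_neg_one_mul_cos_one_le_re_exp ?_
    rw [norm_mul, norm_mul, norm_I, one_mul, norm_real, Real.norm_of_nonneg (Real.cosh_pos t).le]
    calc ‖w‖ * Real.cosh t ≤ ‖w‖ * Real.exp T := by
          gcongr
          exact (cosh_le_exp ht.1.le).trans (Real.exp_le_exp.2 ht.2)
      _ = 1 := by rw [hexpT, mul_inv_cancel₀ hw0.ne']
  have hfar : -(2 * ‖w‖ / w.im) ≤ ∫ t in Ioi T, f t := by
    have htail := integral_Ioi_exp_neg_mul_cosh_le hw T
    rw [Real.exp_neg, hexpT, inv_inv] at htail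
    have hnorm : ‖∫ t in Ioi T, f t‖ ≤ ∫ t in Ioi T, Real.exp (-(w.im * Real.cosh t)) :=
      norm_integral_le_of_norm_le (integrable_exp_neg_mul_cosh hw).integrableOn
        (.of_forall fun t => (abs_re_le_norm _).trans_eq (norm_exp_I_mul_cosh w t))
    linarith [neg_le_of_abs_le (hnorm.trans htail)]
  rw [habs, integral_comp_abs, ← Ioc_union_Ioi_eq_Ioi hT0, setIntegral_union
    (Ioc_disjoint_Ioi le_rfl) measurableSet_Ioi hint.integrableOn hint.integrableOn]
  linarith

end SmallArgument

section GeometricIntegral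

lemma neg_norm_le_re_div_one_sub {q : ℂ} (hq : ‖q‖ < 1) : -‖q‖ ≤ (q / (1 - q)).re := by
  have hne : 1 - q ≠ 0 := sub_ne_zero.2 fun h => by simp [← h] at hq
  have hnormSq : normSq (1 - q) = 1 - 2 * q.re + ‖q‖ ^ 2 := by
    rw [← normSq_eq_norm_sq, normSq_apply, normSq_apply, sub_re, sub_im, one_re, one_im]
    ring
  have hre : (q / (1 - q)).re = (q.re - ‖q‖ ^ 2) / normSq (1 - q) := by
    rw [div_re, ← normSq_eq_norm_sq, normSq_apply q, ← add_div, sub_re, sub_im, one_re, one_im]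
    ring
  rw [hre, le_div_iff₀ (normSq_pos.2 hne), hnormSq]
  obtain ⟨hlower, hupper⟩ := abs_le.1 (abs_re_le_norm q)
  have hnonneg := norm_nonneg q
  rcases le_total (1 - 2 * ‖q‖) 0 with h | h
  · nlinarith [mul_nonneg (neg_nonneg.2 h) (sub_nonneg.2 hupper),
      mul_nonneg (mul_nonneg hnonneg (sub_nonneg.2 hq.le)) (by linarith : 0 ≤ 2 - ‖q‖)]
  · nlinarith [mul_nonneg h (by linarith : 0 ≤ q.re + ‖q‖), pow_nonneg hnonneg 3]

variable {α : Type*} [MeasurableSpace α] {μ : Measure α} {q : α → ℂ} {r : ℝ}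

lemma hasSum_integral_pow_succ (hq : Integrable q μ) (hr : r < 1) (hqr : ∀ t, ‖q t‖ ≤ r) :
    HasSum (fun l : ℕ => ∫ t, q t ^ (l + 1) ∂μ) (∫ t, q t / (1 - q t) ∂μ) := by
  have hle (l : ℕ) (t : α) : ‖q t ^ (l + 1)‖ ≤ r ^ l * ‖q t‖ := by
    rw [norm_pow, pow_succ]
    gcongr
    exact hqr t
  have hint (l : ℕ) : Integrable (fun t => q t ^ (l + 1)) μ :=
    (hq.norm.const_mul (r ^ l)).mono' (hq.aestronglyMeasurable.pow _) (.of_forall (hle l))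
  have hgeom (t : α) : ∑' l : ℕ, q t ^ (l + 1) = q t / (1 - q t) := by
    simp only [pow_succ', tsum_mul_left, div_eq_mul_inv]
    rw [tsum_geometric_of_norm_lt_one ((hqr t).trans_lt hr)]
  rcases isEmpty_or_nonempty α with _ | ⟨⟨t₀⟩⟩
  · simp [Measure.eq_zero_of_isEmpty]
  have hr0 : 0 ≤ r := (norm_nonneg _).trans (hqr t₀)
  simp only [← hgeom]
  refine hasSum_integral_of_summable_integral_norm hint ?_
  refine ((summable_geometric_of_lt_one hr0 hr).mul_right (∫ t, ‖q t‖ ∂μ)).of_nonneg_of_le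
    (fun l => by positivity) fun l => ?_
  rw [← integral_const_mul]
  exact integral_mono (hint l).norm (hq.norm.const_mul _) (hle l)

lemma neg_integral_norm_le_re_integral_div_one_sub (hq : Integrable q μ) (hr : r < 1)
    (hqr : ∀ t, ‖q t‖ ≤ r) : -∫ t, ‖q t‖ ∂μ ≤ (∫ t, q t / (1 - q t) ∂μ).re := by
  have hle (t : α) : ‖q t / (1 - q t)‖ ≤ (1 - r)⁻¹ * ‖q t‖ := by
    have : 1 - r ≤ ‖1 - q t‖ := by
      linarith [norm_sub_norm_le 1 (q t), hqr t, norm_one (α := ℂ)]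
    rw [norm_div, div_eq_inv_mul]
    gcongr
  have hint : Integrable (fun t => q t / (1 - q t)) μ :=
    (hq.norm.const_mul _).mono' (hq.aemeasurable.div
      (aemeasurable_const.sub hq.aemeasurable)).aestronglyMeasurable (.of_forall hle)
  rw [← integral_neg]
  refine (integral_mono hq.norm.neg hint.re fun t => ?_).trans_eq (integral_re hint)
  exact neg_norm_le_re_div_one_sub ((hqr t).trans_lt hr)

end GeometricIntegral

section SymmAnnulus

/-- The annulus about the unit circle, invariant under inversion, onto which `exp` maps the strip
`|re w| < b`. The annulus of the kernel is, by definition, the case `b = Im k * s`. -/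
def symmAnnulus (b : ℝ) : Set ℂ :=
  {z | Real.exp (-b) < ‖z‖ ∧ ‖z‖ < Real.exp b}

variable {b : ℝ} {z : ℂ}

lemma ne_zero_of_mem_symmAnnulus (hz : z ∈ symmAnnulus b) : z ≠ 0 :=
  norm_pos_iff.1 ((Real.exp_pos _).trans hz.1)

lemma inv_mem_symmAnnulus (hz : z ∈ symmAnnulus b) : z⁻¹ ∈ symmAnnulus b := by
  have hpos : 0 < ‖z‖ := norm_pos_iff.2 (ne_zero_of_mem_symmAnnulus hz)
  rw [symmAnnulus, mem_ofPred_eq, norm_inv, lt_inv_comm₀ (Real.exp_pos _) hpos,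
    inv_lt_comm₀ hpos (Real.exp_pos _), ← Real.exp_neg, ← Real.exp_neg, neg_neg]
  exact hz.symm

lemma isOpen_symmAnnulus (b : ℝ) : IsOpen (symmAnnulus b) :=
  (isOpen_lt continuous_const continuous_norm).inter (isOpen_lt continuous_norm continuous_const)

end SymmAnnulus

section Kernel

variable {k : ℂ} {a s : ℝ} {z : ℂ}

lemma kernel_inv (k : ℂ) (a s : ℝ) (z : ℂ) : kernel k a s z⁻¹ = kernel k a s z := by
  simp only [kernel, inv_inv, add_comm]

/-- The half `∑_{l ≥ 1} H₀⁽¹⁾(k s l) z ^ l` of the lattice sum in the kernel. -/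
noncomputable def latticeSeries (k : ℂ) (s : ℝ) (z : ℂ) : ℂ :=
  ∑' l : ℕ, hankel (k * (s * (l + 1) : ℝ)) * z ^ (l + 1)

lemma summable_norm_hankel_mul_pow (hk : 0 < k.im) (hs : 0 < s) {x : ℝ} (hx0 : 0 ≤ x)
    (hx : x < Real.exp (k.im * s)) :
    Summable fun l : ℕ => ‖hankel (k * (s * (l + 1) : ℝ))‖ * x ^ (l + 1) := by
  obtain ⟨C, -, hC⟩ := exists_norm_hankel_le (mul_pos hk hs)
  have hratio : Real.exp (-(k.im * s)) * x < 1 := by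
    rwa [Real.exp_neg, inv_mul_lt_one₀ (Real.exp_pos _)]
  refine (((summable_nat_add_iff 1).2
    (summable_geometric_of_lt_one (by positivity) hratio)).mul_left C).of_nonneg_of_le
    (fun l => by positivity) fun l => ?_
  have him : (k * (s * (l + 1) : ℝ)).im = k.im * s * (l + 1) := by rw [im_mul_ofReal, mul_assoc]
  have hexp : Real.exp (-(k.im * s * (l + 1))) = Real.exp (-(k.im * s)) ^ (l + 1) := by
    rw [← Real.exp_nat_mul]
    push_cast
    ring_nf
  have hle : k.im * s ≤ k.im * s * (l + 1) := by
    nlinarith [mul_pos hk hs, (Nat.cast_nonneg l : (0 : ℝ) ≤ l)]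
  rw [mul_pow, ← mul_assoc, ← hexp, ← him]
  gcongr
  exact hC _ (hle.trans_eq him.symm)

lemma summable_latticeSeries (hk : 0 < k.im) (hs : 0 < s) (hz : ‖z‖ < Real.exp (k.im * s)) :
    Summable fun l : ℕ => hankel (k * (s * (l + 1) : ℝ)) * z ^ (l + 1) := by
  refine .of_norm ?_
  simpa only [norm_mul, norm_pow] using summable_norm_hankel_mul_pow hk hs (norm_nonneg z) hz

lemma kernel_eq_add_latticeSeries (hk : 0 < k.im) (hs : 0 < s) (hz : z ∈ kernelAnnulus k s) :
    kernel k a s z = hankel (k * a) + (latticeSeries k s z + latticeSeries k s z⁻¹) := by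
  rw [kernel, latticeSeries, latticeSeries, ← (summable_latticeSeries hk hs hz.2).tsum_add
    (summable_latticeSeries hk hs (inv_mem_symmAnnulus hz).2)]
  exact congrArg _ (tsum_congr fun l => by ring)

lemma differentiableAt_latticeSeries (hk : 0 < k.im) (hs : 0 < s)
    (hz : ‖z‖ < Real.exp (k.im * s)) : DifferentiableAt ℂ (latticeSeries k s) z := by
  obtain ⟨ρ, hzρ, hρ⟩ := exists_between hz
  have hball : DifferentiableOn ℂ (latticeSeries k s) (ball 0 ρ) := by
    refine differentiableOn_tsum_of_summable_norm
      (summable_norm_hankel_mul_pow hk hs ((norm_nonneg z).trans hzρ.le) hρ)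
      (fun l => by fun_prop) isOpen_ball fun l w hw => ?_
    rw [norm_mul, norm_pow]
    gcongr
    exact (mem_ball_zero_iff.1 hw).le
  exact hball.differentiableAt (isOpen_ball.mem_nhds (mem_ball_zero_iff.2 hzρ))

lemma differentiableOn_kernel (hk : 0 < k.im) (a : ℝ) (hs : 0 < s) :
    DifferentiableOn ℂ (kernel k a s) (kernelAnnulus k s) := by
  refine DifferentiableOn.congr (fun z hz => DifferentiableAt.differentiableWithinAt ?_)
    fun z hz => kernel_eq_add_latticeSeries hk hs hz
  exact ((differentiableAt_latticeSeries hk hs hz.2).add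
    ((differentiableAt_latticeSeries hk hs (inv_mem_symmAnnulus hz).2).comp z
      (differentiableAt_inv (ne_zero_of_mem_symmAnnulus hz)))).const_add _

/-- Under the integral representation of `H₀⁽¹⁾` the lattice sum is an integral of geometric
series, whose real part is bounded below. -/
lemma le_re_pi_mul_I_mul_latticeSeries (hk : 0 < k.im) (hs : 0 < s)
    (hz : ‖z‖ < Real.exp (k.im * s)) :
    -(Real.exp (k.im * s) * ∫ t : ℝ, Real.exp (-(k.im * s * Real.cosh t)))
      ≤ (Real.pi * I * latticeSeries k s z).re := by
  set q : ℝ → ℂ := fun t => z * exp (I * (k * s) * (Real.cosh t : ℂ)) with hq_def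
  have him : (k * s).im = k.im * s := im_mul_ofReal k s
  have hks : 0 < (k * s).im := him ▸ mul_pos hk hs
  have hq : Integrable q := (integrable_exp_I_mul_cosh hks).const_mul z
  have hnorm (t : ℝ) : ‖q t‖ = ‖z‖ * Real.exp (-(k.im * s * Real.cosh t)) := by
    rw [hq_def, norm_mul, norm_exp_I_mul_cosh, him]
  have hqr (t : ℝ) : ‖q t‖ ≤ ‖z‖ * Real.exp (-(k.im * s)) := by
    rw [hnorm]
    gcongr ‖z‖ * Real.exp (-?_)
    exact le_mul_of_one_le_right (mul_pos hk hs).le (Real.one_le_cosh t)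
  have hr : ‖z‖ * Real.exp (-(k.im * s)) < 1 := by
    rwa [Real.exp_neg, mul_inv_lt_iff₀ (Real.exp_pos _), one_mul]
  have hlattice : Real.pi * I * latticeSeries k s z = ∫ t, q t / (1 - q t) := by
    rw [← (hasSum_integral_pow_succ hq hr hqr).tsum_eq, latticeSeries, ← tsum_mul_left]
    refine tsum_congr fun l => ?_
    have hterm (t : ℝ) : q t ^ (l + 1)
        = z ^ (l + 1) * exp (I * (k * (s * (l + 1) : ℝ)) * (Real.cosh t : ℂ)) := by
      rw [hq_def, mul_pow, ← exp_nat_mul]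
      push_cast
      ring_nf
    simp only [hterm, integral_const_mul, hankel]
    field_simp [Real.pi_ne_zero, I_ne_zero]
  calc -(Real.exp (k.im * s) * ∫ t : ℝ, Real.exp (-(k.im * s * Real.cosh t)))
      ≤ -∫ t, ‖q t‖ := by
        simp only [hnorm, integral_const_mul]
        gcongr
    _ ≤ _ := hlattice ▸ neg_integral_norm_le_re_integral_div_one_sub hq hr hqr

lemma le_re_pi_mul_I_mul_kernel (hk : 0 < k.im) (ha : 0 < a) (hs : 0 < s) (hka : ‖k * a‖ ≤ 1)
    (hz : z ∈ kernelAnnulus k s) :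
    2 * (Real.exp (-1) * Real.cos 1 * -Real.log ‖k * a‖ - 2 * ‖k‖ / k.im
        - Real.exp (k.im * s) * ∫ t : ℝ, Real.exp (-(k.im * s * Real.cosh t)))
      ≤ (Real.pi * I * kernel k a s z).re := by
  have hpi : (Real.pi : ℂ) * I ≠ 0 := mul_ne_zero (mod_cast Real.pi_ne_zero) I_ne_zero
  have him : 0 < (k * a).im := by
    rw [im_mul_ofReal]
    exact mul_pos hk ha
  have hratio : 2 * ‖k * a‖ / (k * a).im = 2 * ‖k‖ / k.im := by
    rw [norm_mul, norm_real, Real.norm_of_nonneg ha.le, im_mul_ofReal, ← mul_assoc,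
      mul_div_mul_right _ _ ha.ne']
  have hhankel := le_re_integral_exp_I_mul_cosh him hka
  have hlattice := le_re_pi_mul_I_mul_latticeSeries hk hs hz.2
  have hlattice' := le_re_pi_mul_I_mul_latticeSeries hk hs (inv_mem_symmAnnulus hz).2
  rw [kernel_eq_add_latticeSeries hk hs hz, hankel, mul_add, mul_inv_cancel_left₀ hpi, mul_add,
    add_re, add_re]
  rw [hratio] at hhankel
  linarith

theorem kernelZeroFree_of_small (hk : 0 < k.im) (hs : 0 < s) :
    ∃ ε : ℝ, 0 < ε ∧ ∀ a : ℝ, 0 < a → a < ε → KernelZeroFree k a s := by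
  have hk0 : 0 < ‖k‖ := hk.trans_le ((le_abs_self _).trans (abs_im_le_norm k))
  have hcos : 0 < Real.exp (-1) * Real.cos 1 := mul_pos (Real.exp_pos _) Real.cos_one_pos
  set D := Real.exp (k.im * s) * ∫ t : ℝ, Real.exp (-(k.im * s * Real.cosh t))
  set M := (2 * ‖k‖ / k.im + D) / (Real.exp (-1) * Real.cos 1) with hM
  have hM0 : 0 ≤ M := by positivity
  refine ⟨Real.exp (-M) / ‖k‖, by positivity, fun a ha haε z hz hzero => ?_⟩
  have hka : ‖k * a‖ = ‖k‖ * a := by rw [norm_mul, norm_real, Real.norm_of_nonneg ha.le]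
  have hkaM : ‖k * a‖ < Real.exp (-M) := by rwa [hka, mul_comm, ← lt_div_iff₀ hk0]
  have hlog : M < -Real.log ‖k * a‖ := by
    rwa [lt_neg, Real.log_lt_iff_lt_exp (hka ▸ mul_pos hk0 ha)]
  have hre := le_re_pi_mul_I_mul_kernel hk ha hs (hkaM.le.trans (by simpa using hM0)) hz
  rw [hzero, mul_zero, zero_re] at hre
  rw [hM, div_lt_iff₀' hcos] at hlog
  linarith

end Kernel

section Logarithm

lemma sub_eq_sub_of_exp_eq_exp {S : Set ℂ} (hS : IsOpen S) (hc : IsPreconnected S) {F G : ℂ → ℂ}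
    (hF : DifferentiableOn ℂ F S) (hG : DifferentiableOn ℂ G S)
    (h : ∀ w ∈ S, exp (F w) = exp (G w)) {x y : ℂ} (hx : x ∈ S) (hy : y ∈ S) :
    F x - G x = F y - G y := by
  have hD : DifferentiableOn ℂ (fun w => F w - G w) S := hF.sub hG
  refine hS.is_const_of_deriv_eq_zero hc hD (fun w hw => ?_) hx hy
  have hderiv := (hD.differentiableAt (hS.mem_nhds hw)).hasDerivAt.cexp
  have hone : (fun w => exp (F w - G w)) =ᶠ[nhds w] fun _ => 1 := by
    filter_upwards [hS.mem_nhds hw] with v hv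
    rw [exp_sub, h v hv, div_self (exp_ne_zero _)]
  simpa using hderiv.unique ((hasDerivAt_const w (1 : ℂ)).congr_of_eventuallyEq hone)

lemma exists_differentiableOn_exp_eq_of_convex {S : Set ℂ} (hS : IsOpen S) (hc : Convex ℝ S)
    {f : ℂ → ℂ} (hf : DifferentiableOn ℂ f S) (h0 : ∀ w ∈ S, f w ≠ 0) :
    ∃ G : ℂ → ℂ, DifferentiableOn ℂ G S ∧ ∀ w ∈ S, exp (G w) = f w := by
  rcases S.eq_empty_or_nonempty with rfl | ⟨x, hx⟩
  · exact ⟨0, differentiableOn_empty, by simp⟩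
  obtain ⟨g, hg⟩ := hc.exists_forall_hasDerivWithinAt ((hf.deriv hS).div hf h0)
  have hg' : ∀ w ∈ S, HasDerivAt g (deriv f w / f w) w := fun w hw =>
    (hg w hw).hasDerivAt (hS.mem_nhds hw)
  have hderiv : ∀ w ∈ S, HasDerivAt (fun w => f w * exp (-g w)) 0 w := by
    intro w hw
    have hmul := (hf.differentiableAt (hS.mem_nhds hw)).hasDerivAt.mul (hg' w hw).neg.cexp
    refine hmul.congr_deriv ?_
    have := h0 w hw
    field_simp
    ring
  have hconst : ∀ w ∈ S, f w * exp (-g w) = f x * exp (-g x) := fun w hw =>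
    hS.is_const_of_deriv_eq_zero hc.isPreconnected
      (fun v hv => (hderiv v hv).differentiableAt.differentiableWithinAt)
      (fun v hv => (hderiv v hv).deriv) hw hx
  have hne : f x * exp (-g x) ≠ 0 := mul_ne_zero (h0 x hx) (exp_ne_zero _)
  refine ⟨fun w => g w + log (f x * exp (-g x)),
    fun w hw => ((hg' w hw).differentiableAt.add_const _).differentiableWithinAt, fun w hw => ?_⟩
  rw [exp_add, exp_log hne, ← hconst w hw, exp_neg]
  field_simp [exp_ne_zero]

/-- The vertical strip `|re w| < b`, the covering space of `symmAnnulus b` under `exp`. -/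
def strip (b : ℝ) : Set ℂ :=
  re ⁻¹' Ioo (-b) b

variable {b : ℝ} {f G L : ℂ → ℂ} {w z : ℂ}

lemma isOpen_strip (b : ℝ) : IsOpen (strip b) :=
  isOpen_Ioo.preimage continuous_re

lemma convex_strip (b : ℝ) : Convex ℝ (strip b) :=
  (convex_Ioo (-b) b).linear_preimage reLm

lemma neg_mem_strip (hw : w ∈ strip b) : -w ∈ strip b :=
  ⟨by simpa using hw.2, neg_lt.1 (by simpa using hw.1)⟩

lemma mem_strip_of_re_eq_zero (hw : w ∈ strip b) (hz : z.re = 0) : z ∈ strip b := by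
  have hb : 0 < b := by linarith [hw.1, hw.2]
  exact ⟨by rwa [hz, neg_lt_zero], by rwa [hz]⟩

lemma exp_mem_symmAnnulus : exp w ∈ symmAnnulus b ↔ w ∈ strip b := by
  simp [symmAnnulus, strip, norm_exp]

lemma log_mem_strip (hz : z ∈ symmAnnulus b) : log z ∈ strip b := by
  rwa [← exp_mem_symmAnnulus, exp_log (ne_zero_of_mem_symmAnnulus hz)]

lemma differentiableOn_comp_exp (hf : DifferentiableOn ℂ f (symmAnnulus b)) :
    DifferentiableOn ℂ (fun w => f (exp w)) (strip b) :=
  hf.comp differentiable_exp.differentiableOn fun _ hw => exp_mem_symmAnnulus.2 hw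

lemma apply_neg_of_exp_apply_neg (hG : DifferentiableOn ℂ G (strip b))
    (heven : ∀ w ∈ strip b, exp (G (-w)) = exp (G w)) (hw : w ∈ strip b) : G (-w) = G w := by
  have hneg : DifferentiableOn ℂ (fun w => G (-w)) (strip b) :=
    hG.comp differentiable_neg.differentiableOn fun _ h => neg_mem_strip h
  have hconst := sub_eq_sub_of_exp_eq_exp (isOpen_strip b) (convex_strip b).isPreconnected
    hneg hG heven hw (mem_strip_of_re_eq_zero hw zero_re)
  simpa [sub_eq_zero] using hconst

/-- The constant `G (w + 2π i n) - G w` vanishes at the point `w = -π i n` because `G` is even. -/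
lemma apply_add_int_mul_two_pi_I_of_even (hG : DifferentiableOn ℂ G (strip b))
    (heven : ∀ w ∈ strip b, G (-w) = G w) (n : ℤ)
    (hper : ∀ w ∈ strip b, exp (G (w + n * (2 * Real.pi * I))) = exp (G w)) (hw : w ∈ strip b) :
    G (w + n * (2 * Real.pi * I)) = G w := by
  have hshift : DifferentiableOn ℂ (fun w => G (w + n * (2 * Real.pi * I))) (strip b) :=
    hG.comp (by fun_prop) fun v hv => by simpa [strip] using hv
  have hmid : -(n * (Real.pi * I)) ∈ strip b := mem_strip_of_re_eq_zero hw (by simp)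
  have hconst := sub_eq_sub_of_exp_eq_exp (isOpen_strip b) (convex_strip b).isPreconnected
    hshift hG hper hw hmid
  have hsymm : -(n * (Real.pi * I)) + n * (2 * Real.pi * I) = -(-(n * (Real.pi * I))) := by ring
  rwa [hsymm, heven _ hmid, sub_self, sub_eq_zero] at hconst

lemma differentiableOn_comp_log_of_periodic (hG : DifferentiableOn ℂ G (strip b))
    (hper : ∀ n : ℤ, ∀ w ∈ strip b, G (w + n * (2 * Real.pi * I)) = G w) :
    DifferentiableOn ℂ (fun z => G (log z)) (symmAnnulus b) := by
  intro z hz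
  refine DifferentiableAt.differentiableWithinAt ?_
  have hcomp : ∀ {g : ℂ → ℂ}, g z ∈ strip b → DifferentiableAt ℂ g z →
      DifferentiableAt ℂ (fun w => G (g w)) z := fun hmem hg =>
    (hG.differentiableAt ((isOpen_strip b).mem_nhds hmem)).comp z hg
  by_cases hslit : z ∈ slitPlane
  · exact hcomp (log_mem_strip hz) (differentiableAt_log hslit)
  have hneg : -z ∈ slitPlane :=
    (mem_slitPlane_or_neg_mem_slitPlane (ne_zero_of_mem_symmAnnulus hz)).resolve_left hslit
  have hexp : ∀ w ∈ symmAnnulus b, exp (log (-w) + Real.pi * I) = w := by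
    intro w hw
    rw [exp_add, exp_log (neg_ne_zero.2 (ne_zero_of_mem_symmAnnulus hw)), exp_pi_mul_I]
    ring
  have hmem : ∀ w ∈ symmAnnulus b, log (-w) + Real.pi * I ∈ strip b := by
    intro w hw
    rwa [← exp_mem_symmAnnulus, hexp w hw]
  have heq : (fun w => G (log w)) =ᶠ[nhds z] fun w => G (log (-w) + Real.pi * I) := by
    filter_upwards [(isOpen_symmAnnulus b).mem_nhds hz] with w hw
    obtain ⟨n, hn⟩ := exp_eq_exp_iff_exists_int.1
      ((exp_log (ne_zero_of_mem_symmAnnulus hw)).trans (hexp w hw).symm)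
    rw [hn, hper n _ (hmem w hw)]
  exact (hcomp (hmem z hz) (((differentiableAt_log hneg).comp z
    differentiableAt_id.neg).add_const _)).congr_of_eventuallyEq heq

theorem exists_differentiableOn_exp_eq_of_even (hf : DifferentiableOn ℂ f (symmAnnulus b))
    (h0 : ∀ z ∈ symmAnnulus b, f z ≠ 0) (heven : ∀ z ∈ symmAnnulus b, f z⁻¹ = f z) :
    ∃ L : ℂ → ℂ, DifferentiableOn ℂ L (symmAnnulus b) ∧ ∀ z ∈ symmAnnulus b, exp (L z) = f z := by
  obtain ⟨G, hG, hGf⟩ := exists_differentiableOn_exp_eq_of_convex (isOpen_strip b)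
    (convex_strip b) (differentiableOn_comp_exp hf) fun w hw => h0 _ (exp_mem_symmAnnulus.2 hw)
  have hGeven : ∀ w ∈ strip b, G (-w) = G w := fun w => apply_neg_of_exp_apply_neg hG
    fun v hv => by
      rw [hGf _ (neg_mem_strip hv), hGf _ hv, exp_neg, heven _ (exp_mem_symmAnnulus.2 hv)]
  have hGper : ∀ n : ℤ, ∀ w ∈ strip b, G (w + n * (2 * Real.pi * I)) = G w := fun n w =>
    apply_add_int_mul_two_pi_I_of_even hG hGeven n fun v hv => by
      have hv' : v + n * (2 * Real.pi * I) ∈ strip b := by simpa [strip] using hv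
      rw [hGf _ hv', hGf _ hv, exp_add, exp_int_mul_two_pi_mul_I, mul_one]
  refine ⟨fun z => G (log z), differentiableOn_comp_log_of_periodic hG hGper, fun z hz => ?_⟩
  rw [hGf _ (log_mem_strip hz), exp_log (ne_zero_of_mem_symmAnnulus hz)]

lemma apply_inv_of_exp_apply_inv (hL : DifferentiableOn ℂ L (symmAnnulus b))
    (heven : ∀ z ∈ symmAnnulus b, exp (L z⁻¹) = exp (L z)) (hz : z ∈ symmAnnulus b) :
    L z⁻¹ = L z := by
  have hcomp := apply_neg_of_exp_apply_neg (differentiableOn_comp_exp hL)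
    (fun w hw => by simpa only [exp_neg] using heven _ (exp_mem_symmAnnulus.2 hw))
    (log_mem_strip hz)
  rwa [exp_neg, exp_log (ne_zero_of_mem_symmAnnulus hz)] at hcomp

end Logarithm

section KernelLogarithm

variable {k : ℂ} {a s : ℝ} {L : ℂ → ℂ}

theorem exists_isKernelLog (hk : 0 < k.im) (hs : 0 < s) (hK : KernelZeroFree k a s) :
    ∃ L : ℂ → ℂ, IsKernelLog k a s L :=
  exists_differentiableOn_exp_eq_of_even (differentiableOn_kernel hk a hs) hK
    fun z _ => kernel_inv k a s z

lemma IsKernelLog.apply_inv (hL : IsKernelLog k a s L) {z : ℂ} (hz : z ∈ kernelAnnulus k s) :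
    L z⁻¹ = L z :=
  apply_inv_of_exp_apply_inv hL.1
    (fun w hw => by rw [hL.2 w hw, hL.2 _ (inv_mem_symmAnnulus hw), kernel_inv]) hz

end KernelLogarithm

section CircleIntegral

variable {E : Type*} [NormedAddCommGroup E] [NormedSpace ℂ E] {f : ℂ → E} {c z : ℂ} {r R : ℝ}

lemma circleIntegral_eq_of_differentiableAt (hr : 0 < r) (hle : r ≤ R)
    (hf : ∀ w ∈ closedBall c R \ ball c r, DifferentiableAt ℂ f w) :
    (∮ w in C(c, R), f w) = ∮ w in C(c, r), f w :=
  circleIntegral_eq_of_differentiable_on_annulus_off_countable hr hle countable_empty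
    (fun w hw => (hf w hw).continuousAt.continuousWithinAt)
    fun w hw => hf w ⟨ball_subset_closedBall hw.1.1, fun h => hw.1.2 (ball_subset_closedBall h)⟩

lemma circleIntegral_comp_inv (f : ℂ → E) (hr : r ≠ 0) :
    (∮ w in C(0, r⁻¹), f w) = ∮ w in C(0, r), (w ^ 2)⁻¹ • f w⁻¹ := by
  set g : ℝ → E := fun θ => deriv (circleMap 0 r⁻¹) θ • f (circleMap 0 r⁻¹ θ) with hg
  have hper : Function.Periodic g (2 * Real.pi) := fun θ => by
    simp only [hg, deriv_circleMap, periodic_circleMap 0 r⁻¹ θ]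
  have hreflect : (∮ w in C(0, r), (w ^ 2)⁻¹ • f w⁻¹) = ∫ θ in 0..2 * Real.pi, g (-θ) := by
    refine intervalIntegral.integral_congr fun θ _ => ?_
    have hne : circleMap 0 r θ ≠ 0 := circleMap_ne_center hr
    simp only [hg, deriv_circleMap, ← circleMap_zero_inv, smul_smul]
    congr 1
    field_simp
  have hshift := hper.intervalIntegral_add_eq (-(2 * Real.pi)) 0
  rw [neg_add_cancel, zero_add] at hshift
  rw [hreflect, intervalIntegral.integral_comp_neg, neg_zero, hshift, circleIntegral]

lemma continuousOn_sub_inv_sphere (hz : z ∉ sphere c R) :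
    ContinuousOn (fun w => (w - z)⁻¹) (sphere c R) :=
  ContinuousOn.inv₀ (by fun_prop) fun _ hw h => hz (sub_eq_zero.1 h ▸ hw)

lemma circleIntegral_sub_inv_of_notMem_closedBall (hR : 0 ≤ R) (hz : z ∉ closedBall c R) :
    (∮ w in C(c, R), (w - z)⁻¹) = 0 := by
  have hd : ∀ w ∈ closedBall c R, DifferentiableAt ℂ (fun w => (w - z)⁻¹) w := fun w hw =>
    (differentiableAt_id.sub_const z).inv fun h => hz (sub_eq_zero.1 h ▸ hw)
  exact circleIntegral_eq_zero_of_differentiable_on_off_countable hR countable_empty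
    (fun w hw => (hd w hw).continuousAt.continuousWithinAt)
    fun w hw => hd w (ball_subset_closedBall hw.1)

variable [CompleteSpace E]

lemma circleIntegral_dslope (hR : 0 ≤ R) (hf : ContinuousOn f (sphere c R))
    (hz : z ∉ sphere c R) :
    (∮ w in C(c, R), dslope f z w)
      = (∮ w in C(c, R), (w - z)⁻¹ • f w) - (∮ w in C(c, R), (w - z)⁻¹) • f z := by
  have hinv := continuousOn_sub_inv_sphere hz
  have hint : CircleIntegrable (fun w => (w - z)⁻¹ • f w) c R :=
    (hinv.smul hf).circleIntegrable hR
  have hint' : CircleIntegrable (fun w => (w - z)⁻¹ • f z) c R :=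
    (hinv.smul continuousOn_const).circleIntegrable hR
  rw [← circleIntegral.integral_smul_const, ← circleIntegral.integral_sub hint hint']
  refine circleIntegral.integral_congr hR fun w hw => ?_
  simp only [dslope_of_ne f (ne_of_mem_of_not_mem hw hz), slope_def_module, smul_sub]

lemma circleIntegral_sub_inv_smul_of_mem_annulus {U : Set ℂ} (hU : IsOpen U)
    (hf : DifferentiableOn ℂ f U) (hr : 0 < r) (hsub : closedBall c R \ ball c r ⊆ U)
    (hzR : z ∈ ball c R) (hzr : z ∉ closedBall c r) :
    (∮ w in C(c, R), (w - z)⁻¹ • f w) - (∮ w in C(c, r), (w - z)⁻¹ • f w)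
      = (2 * Real.pi * I : ℂ) • f z := by
  have hle : r ≤ R := ((not_le.1 hzr).trans hzR).le
  have hzU : z ∈ U :=
    hsub ⟨ball_subset_closedBall hzR, fun h => hzr (ball_subset_closedBall h)⟩
  have hslope : DifferentiableOn ℂ (dslope f z) U :=
    (differentiableOn_dslope (hU.mem_nhds hzU)).2 hf
  have heq := circleIntegral_eq_of_differentiableAt hr hle fun w hw =>
    hslope.differentiableAt (hU.mem_nhds (hsub hw))
  have hcont : ∀ ρ, r ≤ ρ → ρ ≤ R → ContinuousOn f (sphere c ρ) := fun ρ h₁ h₂ =>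
    hf.continuousOn.mono fun w hw =>
      hsub ⟨(mem_sphere.1 hw).trans_le h₂, not_lt.2 (h₁.trans_eq (mem_sphere.1 hw).symm)⟩
  rw [circleIntegral_dslope (hr.le.trans hle) (hcont R hle le_rfl) (mem_ball.1 hzR).ne,
    circleIntegral_dslope hr.le (hcont r le_rfl hle) fun h => hzr (sphere_subset_closedBall h),
    circleIntegral.integral_sub_inv_of_mem_ball hzR,
    circleIntegral_sub_inv_of_notMem_closedBall hr.le hzr, zero_smul, sub_zero] at heq
  rw [← heq, sub_sub_cancel]

end CircleIntegral

section Factorization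

/-- The exponent `ln K⁺ z` in Cauchy's formula for `K⁺`, for a branch `L` of `ln K` and the circle
of radius `ρ`. -/
noncomputable def plusExponent (L : ℂ → ℂ) (ρ : ℝ) (z : ℂ) : ℂ :=
  logK0 L ρ - (2 * Real.pi * I)⁻¹ * ∮ ξ in C(0, ρ), L ξ * (z / (z * ξ - 1))

variable {b ρ ρ₁ ρ₂ : ℝ} {L : ℂ → ℂ} {z : ℂ}

lemma inv_mem_Ioo_exp (hρ : ρ ∈ Ioo (Real.exp (-b)) (Real.exp b)) :
    ρ⁻¹ ∈ Ioo (Real.exp (-b)) (Real.exp b) := by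
  have hpos : 0 < ρ := (Real.exp_pos _).trans hρ.1
  have hmem : (ρ : ℂ) ∈ symmAnnulus b := by
    rwa [symmAnnulus, mem_ofPred_eq, norm_real, Real.norm_of_nonneg hpos.le]
  simpa [symmAnnulus, abs_of_pos hpos] using inv_mem_symmAnnulus hmem

lemma annulus_subset_symmAnnulus (h₁ : Real.exp (-b) < ρ₁) (h₂ : ρ₂ < Real.exp b) :
    closedBall 0 ρ₂ \ ball 0 ρ₁ ⊆ symmAnnulus b := fun _ hw =>
  ⟨h₁.trans_le (not_lt.1 fun h => hw.2 (mem_ball_zero_iff.2 h)),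
    (mem_closedBall_zero_iff.1 hw.1).trans_lt h₂⟩

lemma sphere_subset_symmAnnulus (hρ : ρ ∈ Ioo (Real.exp (-b)) (Real.exp b)) :
    sphere 0 ρ ⊆ symmAnnulus b := fun _ hw => by
  rwa [symmAnnulus, mem_ofPred_eq, mem_sphere_zero_iff_norm.1 hw]

lemma exists_radius_mul_norm_lt_one (hb : 0 < b) (hz : ‖z‖ < Real.exp b) :
    ∃ ρ ∈ Ioo (Real.exp (-b)) (Real.exp b), ρ * ‖z‖ < 1 := by
  obtain ⟨ρ, hzρ, hρ⟩ := exists_between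
    (max_lt hz (Real.exp_lt_exp.2 (neg_lt_self hb)))
  have hρ' : ρ ∈ Ioo (Real.exp (-b)) (Real.exp b) := ⟨(le_max_right _ _).trans_lt hzρ, hρ⟩
  refine ⟨ρ⁻¹, inv_mem_Ioo_exp hρ', ?_⟩
  rw [inv_mul_lt_iff₀ ((Real.exp_pos _).trans hρ'.1), mul_one]
  exact (le_max_left _ _).trans_lt hzρ

lemma logK0_congr_radius (hL : DifferentiableOn ℂ L (symmAnnulus b))
    (hρ₁ : ρ₁ ∈ Ioo (Real.exp (-b)) (Real.exp b)) (hρ₂ : ρ₂ ∈ Ioo (Real.exp (-b)) (Real.exp b)) :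
    logK0 L ρ₁ = logK0 L ρ₂ := by
  wlog hle : ρ₂ ≤ ρ₁ generalizing ρ₁ ρ₂
  · exact (this hρ₂ hρ₁ (not_le.1 hle).le).symm
  rw [logK0, logK0, circleIntegral_eq_of_differentiableAt ((Real.exp_pos _).trans hρ₂.1) hle]
  intro w hw
  have hw' := annulus_subset_symmAnnulus hρ₂.1 hρ₁.2 hw
  exact (hL.differentiableAt ((isOpen_symmAnnulus b).mem_nhds hw')).div differentiableAt_id
    (ne_zero_of_mem_symmAnnulus hw')

lemma plusExponent_congr_radius (hL : DifferentiableOn ℂ L (symmAnnulus b))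
    (hρ₁ : ρ₁ ∈ Ioo (Real.exp (-b)) (Real.exp b)) (hρ₂ : ρ₂ ∈ Ioo (Real.exp (-b)) (Real.exp b))
    (h₁ : ρ₁ * ‖z‖ < 1) (h₂ : ρ₂ * ‖z‖ < 1) : plusExponent L ρ₁ z = plusExponent L ρ₂ z := by
  wlog hle : ρ₂ ≤ ρ₁ generalizing ρ₁ ρ₂
  · exact (this hρ₂ hρ₁ h₂ h₁ (not_le.1 hle).le).symm
  rw [plusExponent, plusExponent, logK0_congr_radius hL hρ₁ hρ₂,
    circleIntegral_eq_of_differentiableAt ((Real.exp_pos _).trans hρ₂.1) hle]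
  intro ξ hξ
  have hξL := hL.differentiableAt ((isOpen_symmAnnulus b).mem_nhds
    (annulus_subset_symmAnnulus hρ₂.1 hρ₁.2 hξ))
  have hne : z * ξ - 1 ≠ 0 := fun h0 => by
    have hnorm : ‖z‖ * ‖ξ‖ = 1 := by rw [← norm_mul, sub_eq_zero.1 h0, norm_one]
    have hle' := mul_le_mul_of_nonneg_left (mem_closedBall_zero_iff.1 hξ.1) (norm_nonneg z)
    linarith
  fun_prop (disch := exact hne)

/-- The substitution `ξ = 1 / η` and a partial fraction expansion. -/
lemma circleIntegral_mul_div_mul_sub_one (hρ : 0 < ρ) (hL : ContinuousOn L (sphere 0 ρ))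
    (heven : ∀ η ∈ sphere (0 : ℂ) ρ, L η⁻¹ = L η) (hz : z ∉ sphere (0 : ℂ) ρ) :
    (∮ ξ in C(0, ρ⁻¹), L ξ * (z / (z * ξ - 1)))
      = (∮ η in C(0, ρ), L η / η) - ∮ η in C(0, ρ), (η - z)⁻¹ * L η := by
  have hne0 : ∀ η ∈ sphere (0 : ℂ) ρ, η ≠ 0 := fun η hη => ne_of_mem_sphere hη hρ.ne'
  have hint : CircleIntegrable (fun η => L η / η) 0 ρ :=
    (hL.div continuousOn_id hne0).circleIntegrable hρ.le
  have hint' : CircleIntegrable (fun η => (η - z)⁻¹ * L η) 0 ρ :=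
    ((continuousOn_sub_inv_sphere hz).mul hL).circleIntegrable hρ.le
  rw [circleIntegral_comp_inv _ hρ.ne', ← circleIntegral.integral_sub hint hint']
  refine circleIntegral.integral_congr hρ.le fun η hη => ?_
  have hη0 := hne0 η hη
  have hηz : η - z ≠ 0 := sub_ne_zero.2 (ne_of_mem_of_not_mem hη hz)
  have hzη : z - η ≠ 0 := sub_ne_zero.2 (ne_of_mem_of_not_mem hη hz).symm
  have hdenom : z * η⁻¹ - 1 = (z - η) / η := by field_simp
  simp only [heven η hη, hdenom, smul_eq_mul]
  field_simp
  ring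

lemma logK0_inv (hρ : 0 < ρ) (heven : ∀ η ∈ sphere (0 : ℂ) ρ, L η⁻¹ = L η) :
    logK0 L ρ⁻¹ = logK0 L ρ := by
  rw [logK0, logK0, circleIntegral_comp_inv _ hρ.ne']
  congr 1
  refine circleIntegral.integral_congr hρ.le fun η hη => ?_
  have hη0 : η ≠ 0 := ne_of_mem_sphere hη hρ.ne'
  simp only [heven η hη, smul_eq_mul]
  field_simp

lemma plusExponent_inv (hρ : 0 < ρ) (hL : ContinuousOn L (sphere 0 ρ))
    (heven : ∀ η ∈ sphere (0 : ℂ) ρ, L η⁻¹ = L η) (hz : z ∉ sphere (0 : ℂ) ρ) :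
    plusExponent L ρ⁻¹ z
      = (2 * Real.pi * I)⁻¹ * (∮ η in C(0, ρ), (η - z)⁻¹ * L η) - logK0 L ρ := by
  rw [plusExponent, circleIntegral_mul_div_mul_sub_one hρ hL heven hz, logK0_inv hρ heven, logK0]
  have hpi : (Real.pi : ℂ) ≠ 0 := by exact_mod_cast Real.pi_ne_zero
  have hI := I_ne_zero
  field_simp
  ring

lemma inv_div_inv_mul_sub_one (hz : z ≠ 0) (ξ : ℂ) : z⁻¹ / (z⁻¹ * ξ - 1) = (ξ - z)⁻¹ := by
  rw [show z⁻¹ * ξ - 1 = z⁻¹ * (ξ - z) by field_simp, div_mul_eq_div_div,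
    div_self (inv_ne_zero hz), one_div]

end Factorization

section KernelFactors

variable {k : ℂ} {a s : ℝ} {Kp Km L : ℂ → ℂ} {z : ℂ}

lemma ne_zero_of_mem_OmegaMinus (hz : z ∈ OmegaMinus k s) : z ≠ 0 :=
  norm_pos_iff.1 ((Real.exp_pos _).trans hz)

lemma norm_inv_lt_of_mem_OmegaMinus (hz : z ∈ OmegaMinus k s) :
    ‖z⁻¹‖ < Real.exp (k.im * s) := by
  rw [norm_inv, ← inv_inv (Real.exp _), ← Real.exp_neg]
  exact inv_strictAnti₀ (Real.exp_pos _) hz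

theorem exists_isKernelFactorization (hk : 0 < k.im) (hs : 0 < s)
    (hK : KernelZeroFree k a s) : ∃ Kp Km : ℂ → ℂ, IsKernelFactorization k a s Kp Km := by
  obtain ⟨L, hL⟩ := exists_isKernelLog hk hs hK
  have hradius : ∀ z : ℂ, ‖z‖ < Real.exp (k.im * s) → _ := fun z =>
    exists_radius_mul_norm_lt_one (mul_pos hk hs)
  choose! r hr hrz using hradius
  have hexponent : ∀ ρ ∈ Ioo (Real.exp (-(k.im * s))) (Real.exp (k.im * s)), ∀ z : ℂ,
      ρ * ‖z‖ < 1 → plusExponent L (r z) z = plusExponent L ρ z := by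
    intro ρ hρ z hz
    have hz' : ‖z‖ < Real.exp (k.im * s) := by
      rw [← inv_inv (Real.exp _), ← Real.exp_neg, ← one_div, lt_div_iff₀' (Real.exp_pos _)]
      exact (mul_le_mul_of_nonneg_right hρ.1.le (norm_nonneg z)).trans_lt hz
    exact plusExponent_congr_radius hL.1 (hr z hz') hρ (hrz z hz') hz
  refine ⟨fun z => exp (plusExponent L (r z) z), fun z => exp (plusExponent L (r z⁻¹) z⁻¹), L, hL,
    fun ρ h₁ h₂ => ⟨fun z hz => congrArg exp (hexponent ρ ⟨h₁, h₂⟩ z hz), fun z hz => ?_⟩⟩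
  have hz0 : 0 < ‖z‖ := ((Real.exp_pos _).trans h₁).trans hz
  have hρz : ρ * ‖z⁻¹‖ < 1 := by rwa [norm_inv, ← div_eq_mul_inv, div_lt_one hz0]
  simp only [hexponent ρ ⟨h₁, h₂⟩ _ hρz]
  simp only [plusExponent,
    inv_div_inv_mul_sub_one (norm_pos_iff.1 hz0), div_eq_mul_inv]

lemma IsKernelLog.plusExponent_inv (hL : IsKernelLog k a s L) {ρ : ℝ}
    (hρ : ρ ∈ Ioo (Real.exp (-(k.im * s))) (Real.exp (k.im * s))) (hz : ‖z‖ < ρ) :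
    plusExponent L ρ⁻¹ z
      = (2 * Real.pi * I)⁻¹ * (∮ η in C(0, ρ), (η - z)⁻¹ * L η) - logK0 L ρ :=
  FoldyArrays.plusExponent_inv ((Real.exp_pos _).trans hρ.1)
    (hL.1.continuousOn.mono (sphere_subset_symmAnnulus hρ))
    (fun _ hη => hL.apply_inv (sphere_subset_symmAnnulus hρ hη))
    fun h => hz.ne (mem_sphere_zero_iff_norm.1 h)

namespace IsKernelFactorization

lemma differentiableOn_Kp (hk : 0 < k.im) (hs : 0 < s) (h : IsKernelFactorization k a s Kp Km) :
    DifferentiableOn ℂ Kp {z | ‖z‖ < Real.exp (k.im * s)} := by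
  obtain ⟨L, hL, h⟩ := h
  intro z hz
  obtain ⟨ρ, hzρ, hρ⟩ := exists_between (max_lt hz
    (Real.exp_lt_exp.2 (neg_lt_self (mul_pos hk hs))))
  have hρ' : ρ ∈ Ioo (Real.exp (-(k.im * s))) (Real.exp (k.im * s)) :=
    ⟨(le_max_right _ _).trans_lt hzρ, hρ⟩
  have hpos : 0 < ρ := (Real.exp_pos _).trans hρ'.1
  have hKp : EqOn Kp (fun w => exp ((2 * Real.pi * I)⁻¹ * (∮ η in C(0, ρ), (η - w)⁻¹ * L η)
      - logK0 L ρ)) (ball 0 ρ) := by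
    intro w hw
    rw [mem_ball_zero_iff] at hw
    have hinv := inv_mem_Ioo_exp hρ'
    simp only [← hL.plusExponent_inv hρ' hw]
    exact (h ρ⁻¹ hinv.1 hinv.2).1 w (by rwa [inv_mul_lt_iff₀ hpos, mul_one])
  have hint : CircleIntegrable L 0 ρ :=
    (hL.1.continuousOn.mono (sphere_subset_symmAnnulus hρ')).circleIntegrable hpos.le
  lift ρ to NNReal using hpos.le
  have hcauchy := (hasFPowerSeriesOn_cauchy_integral hint (NNReal.coe_pos.1 hpos)).differentiableOn
  rw [Metric.eball_coe] at hcauchy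
  exact (((hcauchy.sub_const _).cexp.congr hKp).differentiableAt (isOpen_ball.mem_nhds
    (mem_ball_zero_iff.2 ((le_max_left _ _).trans_lt hzρ)))).differentiableWithinAt

lemma Kp_ne_zero (hk : 0 < k.im) (hs : 0 < s) (h : IsKernelFactorization k a s Kp Km)
    (hz : ‖z‖ < Real.exp (k.im * s)) : Kp z ≠ 0 := by
  obtain ⟨_, _, h⟩ := h
  obtain ⟨ρ, hρ, hρz⟩ := exists_radius_mul_norm_lt_one (mul_pos hk hs) hz
  rw [(h ρ hρ.1 hρ.2).1 z hρz]
  exact exp_ne_zero _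

lemma Km_inv (hk : 0 < k.im) (hs : 0 < s) (h : IsKernelFactorization k a s Kp Km) (hz0 : z ≠ 0)
    (hz : ‖z‖ < Real.exp (k.im * s)) : Km z⁻¹ = Kp z := by
  obtain ⟨_, _, h⟩ := h
  obtain ⟨ρ, hρ, hρz⟩ := exists_radius_mul_norm_lt_one (mul_pos hk hs) hz
  have hρz' : ρ < ‖z⁻¹‖ := by rwa [norm_inv, ← one_div, lt_div_iff₀ (norm_pos_iff.2 hz0)]
  have hpole := inv_div_inv_mul_sub_one (inv_ne_zero hz0)
  rw [inv_inv] at hpole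
  simp only [(h ρ hρ.1 hρ.2).1 z hρz, (h ρ hρ.1 hρ.2).2 _ hρz', hpole, div_eq_mul_inv]

lemma Km_eq (hk : 0 < k.im) (hs : 0 < s) (h : IsKernelFactorization k a s Kp Km)
    (hz : z ∈ OmegaMinus k s) : Km z = Kp z⁻¹ := by
  rw [← h.Km_inv hk hs (inv_ne_zero (ne_zero_of_mem_OmegaMinus hz))
    (norm_inv_lt_of_mem_OmegaMinus hz), inv_inv]

lemma differentiableOn_Km (hk : 0 < k.im) (hs : 0 < s) (h : IsKernelFactorization k a s Kp Km) :
    DifferentiableOn ℂ Km (OmegaMinus k s) := by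
  refine ((h.differentiableOn_Kp hk hs).comp (fun z hz => ?_)
    fun z => norm_inv_lt_of_mem_OmegaMinus).congr fun z => h.Km_eq hk hs
  exact (differentiableAt_inv (ne_zero_of_mem_OmegaMinus hz)).differentiableWithinAt

lemma Km_ne_zero (hk : 0 < k.im) (hs : 0 < s) (h : IsKernelFactorization k a s Kp Km)
    (hz : z ∈ OmegaMinus k s) : Km z ≠ 0 := by
  rw [h.Km_eq hk hs hz]
  exact h.Kp_ne_zero hk hs (norm_inv_lt_of_mem_OmegaMinus hz)

/-- Cauchy's formula for `L` on an annulus around `z`: the outer circle gives `ln K⁺ z` and the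
inner circle gives `ln K⁻ z`. -/
theorem kernel_eq_mul (h : IsKernelFactorization k a s Kp Km) (hz : z ∈ kernelAnnulus k s) :
    kernel k a s z = Kp z * Km z := by
  obtain ⟨L, hL, h⟩ := h
  obtain ⟨ρ₁, h₁, hρ₁z⟩ := exists_between hz.1
  obtain ⟨ρ₂, hzρ₂, h₂⟩ := exists_between hz.2
  have hρ₁ : ρ₁ ∈ Ioo _ _ := ⟨h₁, hρ₁z.trans hz.2⟩
  have hρ₂ : ρ₂ ∈ Ioo _ _ := ⟨hz.1.trans hzρ₂, h₂⟩
  have hinv := inv_mem_Ioo_exp hρ₂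
  have hKp : Kp z = exp (plusExponent L ρ₂⁻¹ z) := (h ρ₂⁻¹ hinv.1 hinv.2).1 z
    (by rwa [inv_mul_lt_iff₀ ((Real.exp_pos _).trans hρ₂.1), mul_one])
  have hcauchy := circleIntegral_sub_inv_smul_of_mem_annulus (isOpen_symmAnnulus (k.im * s)) hL.1
    ((Real.exp_pos _).trans h₁) (annulus_subset_symmAnnulus h₁ h₂) (mem_ball_zero_iff.2 hzρ₂)
    fun hmem => hρ₁z.not_ge (mem_closedBall_zero_iff.1 hmem)
  rw [hKp, (h ρ₁ hρ₁.1 hρ₁.2).2 z hρ₁z, ← exp_add, ← hL.2 z hz, hL.plusExponent_inv hρ₂ hzρ₂,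
    logK0_congr_radius hL.1 hρ₁ hρ₂, ← inv_smul_smul₀ two_pi_I_ne_zero (L z), ← hcauchy]
  simp only [smul_eq_mul, div_eq_inv_mul]
  congr 1
  ring

end IsKernelFactorization

end KernelFactors

section Toeplitz

open Finset.HasAntidiagonal (antidiagonal mem_antidiagonal)

variable {R 𝕜 : Type*}

lemma hasSum_sum_antidiagonal [AddCommMonoid R] [TopologicalSpace R] [ContinuousAdd R]
    [RegularSpace R] {f : ℕ × ℕ → R} {c : R} (hf : HasSum f c) :
    HasSum (fun n => ∑ y ∈ antidiagonal n, f y) c := by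
  have hsigma := Finset.HasAntidiagonal.sigmaAntidiagonalEquivProd.hasSum_iff.2 hf
  exact (hsigma.sigma fun n => hasSum_fintype _).congr_fun fun n =>
    (Finset.sum_coe_sort (antidiagonal n) f).symm

/-- The entry in row `m` and column `n` of the lower triangular Toeplitz matrix with symbol
`∑ aₙ zⁿ`. -/
def lowerToeplitzEntry [Zero R] (a : ℕ → R) (m n : ℕ) : R :=
  if n ≤ m then a (m - n) else 0

/-- The lower triangular Toeplitz operator with symbol `∑ aₙ zⁿ`. In terms of Z-transforms it is
multiplication by the symbol. -/
def lowerToeplitz [CommSemiring R] (a A : ℕ → R) (m : ℕ) : R :=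
  ∑ n ∈ Finset.range (m + 1), a (m - n) * A n

/-- The upper triangular Toeplitz operator with symbol `∑ aₙ z⁻ⁿ`, the transpose of
`lowerToeplitz a`. It is meaningful on sequences for which the series converge. -/
noncomputable def upperToeplitz [NormedField 𝕜] (a B : ℕ → 𝕜) (m : ℕ) : 𝕜 :=
  ∑' p : ℕ, a p * B (m + p)

section Algebra

variable [CommSemiring R]

lemma lowerToeplitz_eq_sum_antidiagonal (a A : ℕ → R) (m : ℕ) :
    lowerToeplitz a A m = ∑ y ∈ antidiagonal m, a y.1 * A y.2 := by
  rw [← Finset.Nat.sum_antidiagonal_swap, Finset.Nat.sum_antidiagonal_eq_sum_range_succ_mk,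
    lowerToeplitz]
  rfl

lemma mk_lowerToeplitz (a A : ℕ → R) :
    PowerSeries.mk (lowerToeplitz a A) = PowerSeries.mk a * PowerSeries.mk A := by
  ext m
  simp only [PowerSeries.coeff_mul, PowerSeries.coeff_mk, lowerToeplitz_eq_sum_antidiagonal]

lemma lowerToeplitz_lowerToeplitz (a b A : ℕ → R) :
    lowerToeplitz a (lowerToeplitz b A) = lowerToeplitz (lowerToeplitz a b) A := by
  have hmk : PowerSeries.mk (lowerToeplitz a (lowerToeplitz b A))
      = PowerSeries.mk (lowerToeplitz (lowerToeplitz a b) A) := by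
    simp only [mk_lowerToeplitz, mul_assoc]
  funext m
  simpa only [PowerSeries.coeff_mk] using congrArg (PowerSeries.coeff m) hmk

lemma lowerToeplitz_comm (a A : ℕ → R) : lowerToeplitz a A = lowerToeplitz A a := by
  funext m
  rw [lowerToeplitz_eq_sum_antidiagonal, lowerToeplitz_eq_sum_antidiagonal,
    ← Finset.Nat.sum_antidiagonal_swap]
  exact Finset.sum_congr rfl fun _ _ => mul_comm _ _

lemma lowerToeplitz_single_zero_one (A : ℕ → R) : lowerToeplitz (Pi.single 0 1) A = A := by
  funext m
  rw [lowerToeplitz_comm, lowerToeplitz, Finset.sum_range_succ', Finset.sum_eq_zero] <;> simp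

lemma lowerToeplitz_sum {ι : Type*} (s : Finset ι) (a : ℕ → R) (A : ι → ℕ → R) (m : ℕ) :
    lowerToeplitz a (fun n => ∑ i ∈ s, A i n) m = ∑ i ∈ s, lowerToeplitz a (A i) m := by
  simp only [lowerToeplitz, Finset.mul_sum]
  exact Finset.sum_comm

lemma lowerToeplitz_sub {S : Type*} [CommRing S] (a A B : ℕ → S) (m : ℕ) :
    lowerToeplitz a (fun n => A n - B n) m = lowerToeplitz a A m - lowerToeplitz a B m := by
  simp only [lowerToeplitz, mul_sub, Finset.sum_sub_distrib]

lemma hasSum_lowerToeplitzEntry_mul [TopologicalSpace R] (a A : ℕ → R) (m : ℕ) :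
    HasSum (fun n => lowerToeplitzEntry a m n * A n) (lowerToeplitz a A m) := by
  have hsum : lowerToeplitz a A m
      = ∑ n ∈ Finset.range (m + 1), lowerToeplitzEntry a m n * A n :=
    Finset.sum_congr rfl fun n hn => by
      rw [lowerToeplitzEntry, if_pos (Finset.mem_range_succ_iff.1 hn)]
  rw [hsum]
  refine hasSum_sum_of_ne_finset_zero fun n hn => ?_
  rw [lowerToeplitzEntry, if_neg (mt Finset.mem_range_succ_iff.2 hn), zero_mul]

end Algebra

section Field

variable [NormedField 𝕜]

lemma norm_mul_pow_le_tsum {a : ℕ → 𝕜} {x : ℝ} (hx : 0 ≤ x)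
    (ha : Summable fun n => ‖a n‖ * x ^ n) (n : ℕ) :
    ‖a n‖ * x ^ n ≤ ∑' n, ‖a n‖ * x ^ n :=
  ha.le_tsum n fun _ _ => by positivity

lemma norm_lowerToeplitzEntry_le {a : ℕ → 𝕜} {ρ : ℝ} (hρ : 0 < ρ)
    (ha : Summable fun n => ‖a n‖ * ρ ^ n) (m n : ℕ) :
    ‖lowerToeplitzEntry a m n‖ ≤ (∑' n, ‖a n‖ * ρ ^ n) * (ρ⁻¹ ^ m * ρ ^ n) := by
  have : 0 ≤ ∑' n, ‖a n‖ * ρ ^ n := tsum_nonneg fun _ => by positivity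
  rw [lowerToeplitzEntry]
  split_ifs with hnm
  · have hpow : ρ⁻¹ ^ m * ρ ^ n = (ρ ^ (m - n))⁻¹ := by
      rw [inv_pow, ← Nat.sub_add_cancel hnm, pow_add, Nat.add_sub_cancel]
      field_simp
    rw [hpow, ← div_eq_mul_inv, le_div_iff₀ (pow_pos hρ _)]
    exact norm_mul_pow_le_tsum hρ.le ha _
  · rw [norm_zero]
    positivity

lemma norm_lowerToeplitz_le {a A : ℕ → 𝕜} {ρ : ℝ} (hρ : 0 < ρ)
    (ha : Summable fun n => ‖a n‖ * ρ ^ n) (hA : Summable fun n => ‖A n‖ * ρ ^ n) (m : ℕ) :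
    ‖lowerToeplitz a A m‖ ≤ ((∑' n, ‖a n‖ * ρ ^ n) * ∑' n, ‖A n‖ * ρ ^ n) * ρ⁻¹ ^ m := by
  have hbound : ∀ n, ‖lowerToeplitzEntry a m n * A n‖
      ≤ ((∑' n, ‖a n‖ * ρ ^ n) * ρ⁻¹ ^ m) * (‖A n‖ * ρ ^ n) := fun n => by
    rw [norm_mul]
    refine (mul_le_mul_of_nonneg_right (norm_lowerToeplitzEntry_le hρ ha m n)
      (norm_nonneg _)).trans_eq (by ring)
  refine ((hasSum_lowerToeplitzEntry_mul a A m).norm_le_of_bounded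
    (hA.hasSum.mul_left _) hbound).trans_eq (by ring)

lemma upperToeplitz_single_zero_one (B : ℕ → 𝕜) : upperToeplitz (Pi.single 0 1) B = B := by
  funext m
  rw [upperToeplitz, tsum_eq_single 0 fun p hp => by rw [Pi.single_eq_of_ne hp, zero_mul]]
  simp

variable [CompleteSpace 𝕜] {a b : ℕ → 𝕜} {x : ℝ}

lemma summable_mul_mul_of_norm_le_mul_pow (hx : 0 ≤ x) (ha : Summable fun n => ‖a n‖ * x ^ n)
    (hb : Summable fun n => ‖b n‖ * x ^ n) {B : ℕ → 𝕜} {C : ℝ} (hB : ∀ n, ‖B n‖ ≤ C * x ^ n)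
    (m : ℕ) : Summable fun y : ℕ × ℕ => a y.1 * (b y.2 * B (m + y.1 + y.2)) := by
  refine Summable.of_norm_bounded ((ha.mul_of_nonneg hb (fun n => by positivity)
    (fun n => by positivity)).mul_left (C * x ^ m)) fun y => ?_
  calc ‖a y.1 * (b y.2 * B (m + y.1 + y.2))‖
      = ‖a y.1‖ * (‖b y.2‖ * ‖B (m + y.1 + y.2)‖) := by rw [norm_mul, norm_mul]
    _ ≤ ‖a y.1‖ * (‖b y.2‖ * (C * x ^ (m + y.1 + y.2))) := by
        gcongr
        exact hB _
    _ = C * x ^ m * (‖a y.1‖ * x ^ y.1 * (‖b y.2‖ * x ^ y.2)) := by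
        rw [pow_add, pow_add]
        ring

lemma upperToeplitz_upperToeplitz (hx : 0 ≤ x) (ha : Summable fun n => ‖a n‖ * x ^ n)
    (hb : Summable fun n => ‖b n‖ * x ^ n) {B : ℕ → 𝕜} {C : ℝ} (hB : ∀ n, ‖B n‖ ≤ C * x ^ n) :
    upperToeplitz a (upperToeplitz b B) = upperToeplitz (lowerToeplitz a b) B := by
  funext m
  have hsum := summable_mul_mul_of_norm_le_mul_pow hx ha hb hB m
  have hdiag : ∀ n, ∑ y ∈ antidiagonal n, a y.1 * (b y.2 * B (m + y.1 + y.2))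
      = lowerToeplitz a b n * B (m + n) := fun n => by
    rw [lowerToeplitz_eq_sum_antidiagonal, Finset.sum_mul]
    refine Finset.sum_congr rfl fun y hy => ?_
    rw [add_assoc, mem_antidiagonal.1 hy, mul_assoc]
  calc upperToeplitz a (upperToeplitz b B) m
      = ∑' y : ℕ × ℕ, a y.1 * (b y.2 * B (m + y.1 + y.2)) := by
        rw [hsum.tsum_prod]
        simp only [upperToeplitz, tsum_mul_left]
    _ = upperToeplitz (lowerToeplitz a b) B m :=
        ((hasSum_sum_antidiagonal hsum.hasSum).congr_fun fun n => (hdiag n).symm).tsum_eq.symm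

end Field

section Symmetric

variable [NormedField 𝕜] {a h : ℕ → 𝕜}

lemma hasSum_mul_lowerToeplitzEntry (hh : ∀ d, HasSum (fun i => a (i + d) * a i) (h d))
    (m n : ℕ) :
    HasSum (fun i => a i * lowerToeplitzEntry a (m + i) n) (h ((m : ℤ) - n).natAbs) := by
  rcases le_total n m with hnm | hmn
  · obtain ⟨d, rfl⟩ := Nat.exists_eq_add_of_le' hnm
    rw [show (((d + n : ℕ) : ℤ) - n).natAbs = d by omega]
    refine (hh d).congr_fun fun i => ?_
    rw [lowerToeplitzEntry, if_pos (by omega), mul_comm, show d + n + i - n = i + d by omega]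
  · obtain ⟨d, rfl⟩ := Nat.exists_eq_add_of_le' hmn
    rw [show ((m : ℤ) - (d + m : ℕ)).natAbs = d by omega]
    refine ((add_left_injective d).hasSum_iff fun i hi => ?_).1
      ((hh d).congr_fun fun i => ?_)
    · have hid : i < d := by
        by_contra! hdi
        exact hi ⟨i - d, Nat.sub_add_cancel hdi⟩
      rw [lowerToeplitzEntry, if_neg (by omega), mul_zero]
    · rw [Function.comp_apply, lowerToeplitzEntry, if_pos (by omega),
        show m + (i + d) - (d + m) = i by omega]

lemma hasSum_symmetric_toeplitz [CompleteSpace 𝕜] {A : ℕ → 𝕜} {ρ : ℝ} (hρ : 0 < ρ)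
    (ha : Summable fun n => ‖a n‖ * ρ ^ n) (ha' : Summable fun n => ‖a n‖ * ρ⁻¹ ^ n)
    (hA : Summable fun n => ‖A n‖ * ρ ^ n)
    (hh : ∀ d, HasSum (fun i => a (i + d) * a i) (h d)) (m : ℕ) :
    HasSum (fun n : ℕ => A n * h ((m : ℤ) - n).natAbs)
      (upperToeplitz a (lowerToeplitz a A) m) := by
  have hsum : Summable fun y : ℕ × ℕ =>
      A y.1 * (a y.2 * lowerToeplitzEntry a (m + y.2) y.1) := by
    refine Summable.of_norm_bounded ((hA.mul_of_nonneg ha' (fun n => by positivity)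
      (fun n => by positivity)).mul_left ((∑' n, ‖a n‖ * ρ ^ n) * ρ⁻¹ ^ m)) fun y => ?_
    rw [norm_mul, norm_mul]
    refine (mul_le_mul_of_nonneg_left (mul_le_mul_of_nonneg_left
      (norm_lowerToeplitzEntry_le hρ ha (m + y.2) y.1) (norm_nonneg _))
      (norm_nonneg _)).trans_eq ?_
    rw [pow_add]
    ring
  have hrows := hsum.hasSum.prod_fiberwise fun n =>
    (hasSum_mul_lowerToeplitzEntry hh m n).mul_left (A n)
  have hcol : ∀ i, HasSum (fun n => A n * (a i * lowerToeplitzEntry a (m + i) n))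
      (a i * lowerToeplitz a A (m + i)) := fun i =>
    ((hasSum_lowerToeplitzEntry_mul a A (m + i)).mul_left (a i)).congr_fun fun n => by ring
  have hcols := ((Equiv.prodComm ℕ ℕ).hasSum_iff.2 hsum.hasSum).prod_fiberwise hcol
  rwa [upperToeplitz, hcols.tsum_eq]

end Symmetric

end Toeplitz

section Taylor

/-- The Taylor coefficients of `f` at `0`. -/
noncomputable def taylorCoeff (f : ℂ → ℂ) (n : ℕ) : ℂ :=
  iteratedDeriv n f 0 / (n.factorial : ℂ)

variable {f g : ℂ → ℂ} {r : ℝ}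

lemma lam_eq_taylorCoeff (Kp : ℂ → ℂ) : lam Kp = taylorCoeff fun z => (Kp z)⁻¹ := rfl

lemma hasSum_taylorCoeff (hf : DifferentiableOn ℂ f (ball 0 r)) {z : ℂ} (hz : ‖z‖ < r) :
    HasSum (fun n => taylorCoeff f n * z ^ n) (f z) :=
  (hasSum_taylorSeries_on_ball hf (mem_ball_zero_iff.2 hz)).congr_fun fun n => by
    simp only [taylorCoeff, sub_zero, smul_eq_mul]
    ring

lemma summable_norm_taylorCoeff (hf : DifferentiableOn ℂ f (ball 0 r)) {x : ℝ} (hx0 : 0 ≤ x)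
    (hx : x < r) : Summable fun n => ‖taylorCoeff f n‖ * x ^ n := by
  have hnorm : ‖(x : ℂ)‖ = x := by rw [norm_real, Real.norm_of_nonneg hx0]
  simpa only [norm_mul, norm_pow, hnorm] using
    (hasSum_taylorCoeff hf (hnorm.trans_lt hx)).summable.norm

lemma taylorCoeff_mul (hf : AnalyticAt ℂ f 0) (hg : AnalyticAt ℂ g 0) :
    taylorCoeff (f * g) = lowerToeplitz (taylorCoeff f) (taylorCoeff g) := by
  rw [lowerToeplitz_comm]
  funext n
  rw [taylorCoeff, iteratedDeriv_mul hf.contDiffAt hg.contDiffAt, Finset.sum_div, lowerToeplitz]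
  refine Finset.sum_congr rfl fun i hi => ?_
  have hchoose := Nat.cast_choose ℂ (Finset.mem_range_succ_iff.1 hi)
  have hfact (j : ℕ) : (j.factorial : ℂ) ≠ 0 := mod_cast j.factorial_ne_zero
  have := hfact n
  have := hfact i
  have := hfact (n - i)
  rw [hchoose, taylorCoeff, taylorCoeff]
  field_simp

lemma taylorCoeff_eq_single_of_eventuallyEq_one (hf : f =ᶠ[nhds 0] fun _ => 1) :
    taylorCoeff f = Pi.single 0 1 := by
  funext n
  rw [taylorCoeff, hf.iteratedDeriv_eq, iteratedDeriv_const, Pi.single_apply]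
  split_ifs with hn <;> simp [hn]

lemma lowerToeplitz_taylorCoeff_inv (hf : AnalyticAt ℂ f 0) (h0 : f 0 ≠ 0) :
    lowerToeplitz (taylorCoeff fun z => (f z)⁻¹) (taylorCoeff f) = Pi.single 0 1 := by
  rw [← taylorCoeff_mul (f := fun z => (f z)⁻¹) (hf.inv h0) hf]
  refine taylorCoeff_eq_single_of_eventuallyEq_one ?_
  filter_upwards [hf.continuousAt.eventually_ne h0] with z hz
  exact inv_mul_cancel₀ hz

end Taylor

section GeometricSequence

lemma hasSum_taylorCoeff_mul_geometric {f : ℂ → ℂ} {r : ℝ}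
    (hf : DifferentiableOn ℂ f (ball 0 r)) (c : ℂ) {w : ℂ} (hw : ‖w‖ < r) (m : ℕ) :
    HasSum (fun p => taylorCoeff f p * (c * w ^ (m + p))) (c * w ^ m * f w) :=
  ((hasSum_taylorCoeff hf hw).mul_left (c * w ^ m)).congr_fun fun p => by rw [pow_add]; ring

lemma lowerToeplitz_geometric {𝕜 : Type*} [Field 𝕜] (b : ℕ → 𝕜) (c z : 𝕜) (m : ℕ) :
    lowerToeplitz b (fun n => c * z⁻¹ ^ n) m
      = c * ∑ n ∈ Finset.range (m + 1), b n * z ^ ((n : ℤ) - (m : ℤ)) := by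
  rw [lowerToeplitz_comm, lowerToeplitz, Finset.mul_sum]
  refine Finset.sum_congr rfl fun n hn => ?_
  rw [← neg_sub (m : ℤ), ← Nat.cast_sub (Finset.mem_range_succ_iff.1 hn), zpow_neg, zpow_natCast,
    inv_pow]
  ring

variable {𝕜 : Type*} [NormedField 𝕜]

lemma summable_norm_mul_inv_pow_mul_pow (c : 𝕜) {w : 𝕜} {ρ : ℝ} (hρ0 : 0 ≤ ρ) (hρ : ρ < ‖w‖) :
    Summable fun n : ℕ => ‖c * w⁻¹ ^ n‖ * ρ ^ n := by
  have hlt : ‖w‖⁻¹ * ρ < 1 := by rwa [inv_mul_lt_iff₀ (hρ0.trans_lt hρ), mul_one]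
  refine ((summable_geometric_of_lt_one (by positivity) hlt).mul_left ‖c‖).congr fun n => ?_
  rw [norm_mul, norm_pow, norm_inv, mul_pow, mul_assoc]

lemma summable_mul_pow_of_norm_le_mul_inv_pow [CompleteSpace 𝕜] {A : ℕ → 𝕜} {C ρ : ℝ}
    (hA : ∀ n, ‖A n‖ ≤ C * ρ⁻¹ ^ n) {z : 𝕜} (hz : ‖z‖ < ρ) :
    Summable fun n => A n * z ^ n := by
  have hρ : 0 < ρ := (norm_nonneg z).trans_lt hz
  have hlt : ρ⁻¹ * ‖z‖ < 1 := by rwa [inv_mul_lt_iff₀ hρ, mul_one]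
  refine .of_norm_bounded
    ((summable_geometric_of_lt_one (by positivity) hlt).mul_left C) fun n => ?_
  rw [norm_mul, norm_pow, mul_pow, ← mul_assoc]
  exact mul_le_mul_of_nonneg_right (hA n) (by positivity)

end GeometricSequence

section Laurent

variable {ι : Type*} [Countable ι] {r : ℝ}

lemma hasSum_circleIntegral_of_norm_le {E : Type*} [NormedAddCommGroup E] [NormedSpace ℂ E]
    {F : ι → ℂ → E} {f : ℂ → E} {c : ℂ} {u : ι → ℝ} (hr : 0 ≤ r)
    (hF : ∀ i, ContinuousOn (F i) (sphere c r)) (hu : Summable u)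
    (hFu : ∀ i, ∀ z ∈ sphere c r, ‖F i z‖ ≤ u i)
    (hf : ∀ z ∈ sphere c r, HasSum (fun i => F i z) (f z)) :
    HasSum (fun i => ∮ z in C(c, r), F i z) (∮ z in C(c, r), f z) := by
  refine intervalIntegral.hasSum_integral_of_dominated_convergence (fun i _ => r * u i)
    (fun i => ?_) (fun i => .of_forall fun θ _ => ?_) (.of_forall fun _ _ => hu.mul_left r)
    intervalIntegrable_const
    (.of_forall fun θ _ => (hf _ (circleMap_mem_sphere c hr θ)).const_smul _)
  · simp only [deriv_circleMap]
    exact (((continuous_circleMap 0 r).mul continuous_const).smul ((hF i).comp_continuous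
      (continuous_circleMap c r) (circleMap_mem_sphere c hr))).aestronglyMeasurable
  · rw [norm_smul, deriv_circleMap, norm_mul, norm_circleMap_zero, norm_I, mul_one,
      abs_of_nonneg hr]
    exact mul_le_mul_of_nonneg_left (hFu i _ (circleMap_mem_sphere c hr θ)) hr

lemma circleIntegral_zpow (hr : r ≠ 0) (n : ℤ) :
    ∮ z in C(0, r), z ^ n = if n = -1 then 2 * Real.pi * I else 0 := by
  split_ifs with hn
  · simpa only [hn, zpow_neg_one, sub_zero] using circleIntegral.integral_sub_center_inv 0 hr
  · simpa only [sub_zero] using circleIntegral.integral_sub_zpow_of_ne hn 0 0 r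

variable {c : ι → ℂ} {e : ι → ℤ} {f : ℂ → ℂ}

lemma hasSum_laurentCoeff (hr : 0 < r) (hc : Summable fun i => ‖c i‖ * r ^ e i)
    (hf : ∀ z ∈ sphere (0 : ℂ) r, HasSum (fun i => c i * z ^ e i) (f z)) (m : ℤ) :
    HasSum (fun i => if e i = m then c i else 0)
      ((2 * Real.pi * I)⁻¹ * ∮ z in C(0, r), z ^ (-m - 1) * f z) := by
  have hnorm {z : ℂ} (hz : z ∈ sphere (0 : ℂ) r) : ‖z‖ = r := mem_sphere_zero_iff_norm.1 hz
  have hne {z : ℂ} (hz : z ∈ sphere (0 : ℂ) r) : z ≠ 0 := norm_pos_iff.1 ((hnorm hz).symm ▸ hr)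
  have hsum : HasSum (fun i => ∮ z in C(0, r), z ^ (-m - 1) * (c i * z ^ e i))
      (∮ z in C(0, r), z ^ (-m - 1) * f z) := by
    refine hasSum_circleIntegral_of_norm_le hr.le (fun i => ?_) (hc.mul_left (r ^ (-m - 1)))
      (fun i z hz => ?_) fun z hz => (hf z hz).mul_left _
    · have hpow (n : ℤ) : ContinuousOn (fun z : ℂ => z ^ n) (sphere 0 r) := fun z hz =>
        (continuousAt_zpow₀ z n (.inl (hne hz))).continuousWithinAt
      exact (hpow _).mul (continuousOn_const.mul (hpow _))
    · rw [norm_mul, norm_mul, norm_zpow, norm_zpow, hnorm hz]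
  refine (hsum.mul_left _).congr_fun fun i => ?_
  have hterm : ∮ z in C(0, r), z ^ (-m - 1) * (c i * z ^ e i)
      = c i * ∮ z in C(0, r), z ^ (e i - m - 1) := by
    rw [← circleIntegral.integral_const_mul]
    refine circleIntegral.integral_congr hr.le fun z hz => ?_
    rw [mul_left_comm, ← zpow_add₀ (hne hz)]
    ring_nf
  rw [hterm, circleIntegral_zpow hr.ne']
  by_cases him : e i = m
  · rw [if_pos him, if_pos (by omega), mul_comm, mul_inv_cancel_right₀ two_pi_I_ne_zero]
  · rw [if_neg him, if_neg (by omega), mul_zero, mul_zero]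

lemma hasSum_of_hasSum_laurent (hr : 0 < r) {b : ℤ → ℂ}
    (hb : ∀ z ∈ sphere (0 : ℂ) r, HasSum (fun l => b l * z ^ l) (f z))
    (hc : Summable fun i => ‖c i‖ * r ^ e i)
    (hf : ∀ z ∈ sphere (0 : ℂ) r, HasSum (fun i => c i * z ^ e i) (f z)) (m : ℤ) :
    HasSum (fun i => if e i = m then c i else 0) (b m) := by
  have hbr : Summable fun l => ‖b l‖ * r ^ l := by
    have hrnorm : ‖(r : ℂ)‖ = r := by rw [norm_real, Real.norm_of_nonneg hr.le]
    simpa only [norm_mul, norm_zpow, hrnorm] using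
      (hb r (mem_sphere_zero_iff_norm.2 hrnorm)).summable.norm
  have hbm := (hasSum_laurentCoeff hr hbr hb m).unique
    ((hasSum_ite_eq m (b m)).congr_fun fun l => by split_ifs with h <;> simp [h])
  exact hbm ▸ hasSum_laurentCoeff hr hc hf m

lemma hasSum_taylorCoeff_mul_inv {f g : ℂ → ℂ} (hf : DifferentiableOn ℂ f (ball 0 r))
    (hg : DifferentiableOn ℂ g (ball 0 r)) {z : ℂ} (hz0 : z ≠ 0) (hz : ‖z‖ < r)
    (hz' : ‖z⁻¹‖ < r) :
    HasSum (fun y : ℕ × ℕ => taylorCoeff f y.1 * taylorCoeff g y.2 * z ^ ((y.1 : ℤ) - y.2))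
      (f z * g z⁻¹) := by
  have hfz := hasSum_taylorCoeff hf hz
  have hgz := hasSum_taylorCoeff hg hz'
  have hsum := summable_mul_of_summable_norm hfz.summable.norm hgz.summable.norm
  have hprod := hfz.mul hgz hsum
  refine hprod.congr_fun fun y => ?_
  rw [zpow_sub₀ hz0, zpow_natCast, zpow_natCast, inv_pow, div_eq_mul_inv]
  ring

/-- Multiplying the Taylor series of `f z` and `g z⁻¹` and comparing Laurent coefficients. -/
lemma hasSum_taylorCoeff_add_mul {f g : ℂ → ℂ} (hr : 1 < r) (hf : DifferentiableOn ℂ f (ball 0 r))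
    (hg : DifferentiableOn ℂ g (ball 0 r)) {b : ℤ → ℂ}
    (hb : ∀ z ∈ sphere (0 : ℂ) 1, HasSum (fun l => b l * z ^ l) (f z * g z⁻¹)) (d : ℕ) :
    HasSum (fun i => taylorCoeff f (i + d) * taylorCoeff g i) (b d) := by
  have hprod : ∀ z ∈ sphere (0 : ℂ) 1, HasSum (fun y : ℕ × ℕ =>
      taylorCoeff f y.1 * taylorCoeff g y.2 * z ^ ((y.1 : ℤ) - y.2)) (f z * g z⁻¹) := by
    intro z hz
    have hz1 : ‖z‖ = 1 := mem_sphere_zero_iff_norm.1 hz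
    refine hasSum_taylorCoeff_mul_inv hf hg (norm_ne_zero_iff.1 (hz1 ▸ one_ne_zero)) ?_ ?_
    · rwa [hz1]
    · rwa [norm_inv, hz1, inv_one]
  have hsum : Summable fun y : ℕ × ℕ =>
      ‖taylorCoeff f y.1 * taylorCoeff g y.2‖ * (1 : ℝ) ^ ((y.1 : ℤ) - y.2) := by
    simpa using (hprod 1 (by simp)).summable.norm
  have hdiag := hasSum_of_hasSum_laurent one_pos hb hsum hprod d
  have hinj : Function.Injective fun i : ℕ => (i + d, i) := fun i j hij => congrArg Prod.snd hij
  refine ((hinj.hasSum_iff fun y hy => if_neg fun hyd => ?_).2 hdiag).congr_fun fun i => ?_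
  · exact hy ⟨y.2, Prod.ext (by dsimp only; omega) rfl⟩
  · rw [Function.comp_apply, if_pos (by push_cast; ring)]

end Laurent

section KernelCoefficients

/-- The Laurent coefficient of `z ^ d` and `z ^ (-d)` in the kernel, that is, the coupling between
two scatterers of the array whose indices differ by `d`. -/
noncomputable def kernelCoeff (k : ℂ) (a s : ℝ) (d : ℕ) : ℂ :=
  if d = 0 then hankel (k * a) else hankel (k * (s * d : ℝ))

variable {k : ℂ} {a s : ℝ} {Kp Km : ℂ → ℂ} {z : ℂ}

lemma hasSum_kernelCoeff (hk : 0 < k.im) (hs : 0 < s) (hz : z ∈ kernelAnnulus k s) :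
    HasSum (fun l : ℤ => kernelCoeff k a s l.natAbs * z ^ l) (kernel k a s z) := by
  have hsucc (n : ℕ) :
      kernelCoeff k a s (n + 1) = hankel (k * (s * (n + 1) : ℝ)) := by
    rw [kernelCoeff, if_neg n.succ_ne_zero, Nat.cast_succ]
  have hpos : HasSum (fun n : ℕ => kernelCoeff k a s n * z ^ n)
      (hankel (k * a) + latticeSeries k s z) := by
    refine (hasSum_nat_add_iff' 1).1 ?_
    simpa [hsucc, kernelCoeff, latticeSeries] using (summable_latticeSeries hk hs hz.2).hasSum
  have hneg : HasSum (fun n : ℕ => kernelCoeff k a s (n + 1) * z⁻¹ ^ (n + 1))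
      (latticeSeries k s z⁻¹) := by
    simpa only [hsucc, latticeSeries] using
      (summable_latticeSeries hk hs (inv_mem_symmAnnulus hz).2).hasSum
  rw [kernel_eq_add_latticeSeries hk hs hz, ← add_assoc]
  refine HasSum.of_nat_of_neg_add_one (hpos.congr_fun fun n => ?_) (hneg.congr_fun fun n => ?_)
  · rw [Int.natAbs_natCast, zpow_natCast]
  · rw [Int.natAbs_neg, ← Nat.cast_succ, Int.natAbs_natCast, zpow_neg, zpow_natCast, inv_pow]

namespace IsKernelFactorization

lemma differentiableOn_ball (hk : 0 < k.im) (hs : 0 < s)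
    (h : IsKernelFactorization k a s Kp Km) :
    DifferentiableOn ℂ Kp (ball 0 (Real.exp (k.im * s))) :=
  (h.differentiableOn_Kp hk hs).mono fun _ hz => mem_ball_zero_iff.1 hz

lemma differentiableOn_inv (hk : 0 < k.im) (hs : 0 < s)
    (h : IsKernelFactorization k a s Kp Km) :
    DifferentiableOn ℂ (fun z => (Kp z)⁻¹) (ball 0 (Real.exp (k.im * s))) :=
  (h.differentiableOn_ball hk hs).inv fun _ hz => h.Kp_ne_zero hk hs (mem_ball_zero_iff.1 hz)

lemma summable_taylorCoeff (hk : 0 < k.im) (hs : 0 < s) (h : IsKernelFactorization k a s Kp Km)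
    {x : ℝ} (hx0 : 0 ≤ x) (hx : x < Real.exp (k.im * s)) :
    Summable fun n => ‖taylorCoeff Kp n‖ * x ^ n :=
  summable_norm_taylorCoeff (h.differentiableOn_ball hk hs) hx0 hx

lemma summable_lam (hk : 0 < k.im) (hs : 0 < s) (h : IsKernelFactorization k a s Kp Km)
    {x : ℝ} (hx0 : 0 ≤ x) (hx : x < Real.exp (k.im * s)) :
    Summable fun n => ‖lam Kp n‖ * x ^ n :=
  summable_norm_taylorCoeff (h.differentiableOn_inv hk hs) hx0 hx

lemma lowerToeplitz_lam_taylorCoeff (hk : 0 < k.im) (hs : 0 < s)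
    (h : IsKernelFactorization k a s Kp Km) :
    lowerToeplitz (lam Kp) (taylorCoeff Kp) = Pi.single 0 1 := by
  refine lowerToeplitz_taylorCoeff_inv ?_ (h.Kp_ne_zero hk hs (by simpa using Real.exp_pos _))
  exact (h.differentiableOn_ball hk hs).analyticAt (ball_mem_nhds _ (Real.exp_pos _))

lemma hasSum_taylorCoeff_add_mul (hk : 0 < k.im) (hs : 0 < s)
    (h : IsKernelFactorization k a s Kp Km) (d : ℕ) :
    HasSum (fun i => taylorCoeff Kp (i + d) * taylorCoeff Kp i) (kernelCoeff k a s d) := by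
  have hb : 0 < k.im * s := mul_pos hk hs
  have hKp := h.differentiableOn_ball hk hs
  refine FoldyArrays.hasSum_taylorCoeff_add_mul (Real.one_lt_exp_iff.2 hb) hKp hKp
    (b := fun l => kernelCoeff k a s l.natAbs) (fun z hz => ?_) d
  have hz1 : ‖z‖ = 1 := mem_sphere_zero_iff_norm.1 hz
  have hzK : z ∈ kernelAnnulus k s :=
    ⟨by rwa [hz1, Real.exp_lt_one_iff, neg_lt_zero], by rwa [hz1, Real.one_lt_exp_iff]⟩
  rw [← h.Km_eq hk hs hzK.1, ← h.kernel_eq_mul hzK]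
  exact hasSum_kernelCoeff hk hs hzK

end IsKernelFactorization

end KernelCoefficients

section FoldyOperator

/-- The left-hand side of the Foldy system of a single array: the symmetric Toeplitz operator
with symbol `kernel k a s`. -/
noncomputable def foldyOperator (k : ℂ) (a s : ℝ) (A : ℕ → ℂ) (m : ℕ) : ℂ :=
  A m * hankel (k * a)
    + ∑' n : ℕ, (if n = m then 0 else A n * hankel (k * (s * |(m : ℝ) - (n : ℝ)| : ℝ)))

variable {k : ℂ} {a s ρ : ℝ} {Kp Km : ℂ → ℂ} {A : ℕ → ℂ}

lemma kernelCoeff_natAbs_sub {m n : ℕ} (hmn : n ≠ m) :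
    kernelCoeff k a s ((m : ℤ) - n).natAbs = hankel (k * (s * |(m : ℝ) - n| : ℝ)) := by
  rw [kernelCoeff, if_neg (by omega), Nat.cast_natAbs]
  push_cast
  rfl

lemma foldyOperator_eq_of_hasSum {T : ℂ} {m : ℕ}
    (hT : HasSum (fun n : ℕ => A n * kernelCoeff k a s ((m : ℤ) - n).natAbs) T) :
    foldyOperator k a s A m = T := by
  rw [← hT.tsum_eq, hT.summable.tsum_eq_add_tsum_ite m, foldyOperator]
  congr 1
  · simp [kernelCoeff]
  · refine tsum_congr fun n => ?_
    split_ifs with hn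
    · rfl
    · rw [kernelCoeff_natAbs_sub hn]

lemma foldyOperator_eq_upperToeplitz (hk : 0 < k.im) (hs : 0 < s)
    (h : IsKernelFactorization k a s Kp Km)
    (hρ : ρ ∈ Ioo (Real.exp (-(k.im * s))) (Real.exp (k.im * s)))
    (hA : Summable fun n => ‖A n‖ * ρ ^ n) :
    foldyOperator k a s A
      = upperToeplitz (taylorCoeff Kp) (lowerToeplitz (taylorCoeff Kp) A) := by
  have hρ0 : 0 < ρ := (Real.exp_pos _).trans hρ.1
  funext m
  exact foldyOperator_eq_of_hasSum <| hasSum_symmetric_toeplitz hρ0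
    (h.summable_taylorCoeff hk hs hρ0.le hρ.2)
    (h.summable_taylorCoeff hk hs (inv_nonneg.2 hρ0.le) (inv_mem_Ioo_exp hρ).2) hA
    (h.hasSum_taylorCoeff_add_mul hk hs) m

lemma eq_lowerToeplitz_upperToeplitz_foldyOperator (hk : 0 < k.im) (hs : 0 < s)
    (h : IsKernelFactorization k a s Kp Km)
    (hρ : ρ ∈ Ioo (Real.exp (-(k.im * s))) (Real.exp (k.im * s)))
    (hA : Summable fun n => ‖A n‖ * ρ ^ n) :
    A = lowerToeplitz (lam Kp) (upperToeplitz (lam Kp) (foldyOperator k a s A)) := by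
  have hρ0 : 0 < ρ := (Real.exp_pos _).trans hρ.1
  have hupper : upperToeplitz (lam Kp) (foldyOperator k a s A)
      = lowerToeplitz (taylorCoeff Kp) A := by
    rw [foldyOperator_eq_upperToeplitz hk hs h hρ hA, upperToeplitz_upperToeplitz
      (inv_nonneg.2 hρ0.le)
      (h.summable_lam hk hs (inv_nonneg.2 hρ0.le) (inv_mem_Ioo_exp hρ).2)
      (h.summable_taylorCoeff hk hs (inv_nonneg.2 hρ0.le) (inv_mem_Ioo_exp hρ).2)
      (norm_lowerToeplitz_le hρ0 (h.summable_taylorCoeff hk hs hρ0.le hρ.2) hA),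
      h.lowerToeplitz_lam_taylorCoeff hk hs, upperToeplitz_single_zero_one]
  rw [hupper, lowerToeplitz_lowerToeplitz, h.lowerToeplitz_lam_taylorCoeff hk hs,
    lowerToeplitz_single_zero_one]

end FoldyOperator

section Geometry

variable {X Y : SemiInfiniteArray}

lemma dist_pos_zero (hs : 0 ≤ X.s) (n : ℕ) : dist (X.pos n) (X.pos 0) = n * X.s := by
  have hns : (0 : ℝ) ≤ n * X.s := by positivity
  rw [EuclideanSpace.dist_eq, Real.sqrt_eq_iff_eq_sq (by positivity) hns, Fin.sum_univ_two]
  simp only [SemiInfiniteArray.pos, Real.dist_eq, sq_abs, PiLp.toLp_apply, Matrix.cons_val_zero,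
    Matrix.cons_val_one, CharP.cast_eq_zero, zero_mul, add_zero, add_sub_cancel_left]
  linear_combination (n * X.s) ^ 2 * Real.cos_sq_add_sin_sq X.α

lemma le_scattererDist (hX : 0 ≤ X.s) (hY : 0 ≤ Y.s) (m q : ℕ) :
    q * Y.s - m * X.s - dist (X.pos 0) (Y.pos 0) ≤ scattererDist X Y m q := by
  have htri := dist_triangle4 (Y.pos q) (X.pos m) (X.pos 0) (Y.pos 0)
  rw [dist_pos_zero hY, dist_pos_zero hX, dist_comm (Y.pos q)] at htri
  rw [scattererDist]
  linarith

end Geometry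

section ForcingPole

variable {k : ℂ} {θI : ℝ} {X : SemiInfiniteArray}

lemma incident_pos (k : ℂ) (θI : ℝ) (X : SemiInfiniteArray) (m : ℕ) :
    incident k θI (X.pos m) = incident k θI (X.pos 0) * (pole k θI X)⁻¹ ^ m := by
  rw [incident, incident, pole, ← exp_neg, ← exp_nat_mul, ← exp_add, Real.cos_sub]
  congr 1
  simp only [SemiInfiniteArray.pos, PiLp.toLp_apply, Matrix.cons_val_zero, Matrix.cons_val_one]
  push_cast
  ring

lemma norm_pole (k : ℂ) (θI : ℝ) (X : SemiInfiniteArray) :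
    ‖pole k θI X‖ = Real.exp (-(k.im * X.s * Real.cos (X.α - θI))) := by
  rw [pole, norm_exp, re_mul_ofReal, I_mul_re]
  ring_nf

lemma mem_OmegaPlus_iff {z : ℂ} : z ∈ OmegaPlus k θI X ↔ ‖z‖ < ‖pole k θI X‖ := by
  rw [norm_pole, OmegaPlus, mem_ofPred_eq]

lemma pole_mem_OmegaMinus (hX : (OmegaPlus k θI X ∩ OmegaMinus k X.s).Nonempty) :
    pole k θI X ∈ OmegaMinus k X.s := by
  obtain ⟨z, hz, hz'⟩ := hX
  exact lt_trans hz' (mem_OmegaPlus_iff.1 hz)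

lemma cos_lt_one_of_nonempty (hk : 0 < k.im) (hs : 0 < X.s)
    (hX : (OmegaPlus k θI X ∩ OmegaMinus k X.s).Nonempty) : Real.cos (X.α - θI) < 1 := by
  have hpole : Real.exp (-(k.im * X.s)) < ‖pole k θI X‖ := pole_mem_OmegaMinus hX
  rw [norm_pole, Real.exp_lt_exp, neg_lt_neg_iff] at hpole
  exact (mul_lt_iff_lt_one_right (mul_pos hk hs)).1 hpole

lemma norm_pole_le (hk : 0 ≤ k.im) (hs : 0 ≤ X.s) : ‖pole k θI X‖ ≤ Real.exp (k.im * X.s) := by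
  rw [norm_pole, Real.exp_le_exp, ← mul_neg]
  exact mul_le_of_le_one_right (mul_nonneg hk hs) (neg_le.1 (Real.neg_one_le_cos _))

lemma exists_mem_Ioo_lt_norm_pole (hk : 0 ≤ k.im) (hs : 0 ≤ X.s)
    (hX : (OmegaPlus k θI X ∩ OmegaMinus k X.s).Nonempty) :
    ∃ ρ ∈ Ioo (Real.exp (-(k.im * X.s))) (Real.exp (k.im * X.s)), ρ < ‖pole k θI X‖ :=
  have ⟨ρ, hρ, hρpole⟩ := exists_between
    (show Real.exp (-(k.im * X.s)) < ‖pole k θI X‖ from pole_mem_OmegaMinus hX)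
  ⟨ρ, ⟨hρ, hρpole.trans_le (norm_pole_le hk hs)⟩, hρpole⟩

lemma ZTransformConverges.summable_norm {A : ℕ → ℂ} (hA : ZTransformConverges k θI X A) {ρ : ℝ}
    (hρ0 : 0 ≤ ρ) (hρ : ρ < ‖pole k θI X‖) : Summable fun n => ‖A n‖ * ρ ^ n := by
  have hρnorm : ‖(ρ : ℂ)‖ = ρ := by rw [norm_real, Real.norm_of_nonneg hρ0]
  have hsum := (hA ρ (mem_OmegaPlus_iff.2 (hρnorm.trans_lt hρ))).norm
  simpa only [norm_mul, norm_pow, hρnorm] using hsum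

end ForcingPole

section SingleArray

variable {k : ℂ} {θI : ℝ} {X : SemiInfiniteArray} {Kp Km : ℂ → ℂ}

lemma singleArray_eq_lowerToeplitz : singleArray k θI X Kp Km = lowerToeplitz (lam Kp)
    (fun n => -(incident k θI (X.pos 0) / Km (pole k θI X)) * (pole k θI X)⁻¹ ^ n) := by
  funext m
  rw [lowerToeplitz_geometric, singleArray]

theorem zTransformConverges_singleArray (hk : 0 < k.im) (hs : 0 < X.s)
    (h : IsKernelFactorization k X.a X.s Kp Km) :
    ZTransformConverges k θI X (singleArray k θI X Kp Km) := by
  intro z hz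
  obtain ⟨ρ, hzρ, hρ⟩ := exists_between (mem_OmegaPlus_iff.1 hz)
  have hρ0 : 0 < ρ := (norm_nonneg z).trans_lt hzρ
  rw [singleArray_eq_lowerToeplitz]
  exact summable_mul_pow_of_norm_le_mul_inv_pow (norm_lowerToeplitz_le hρ0
    (h.summable_lam hk hs hρ0.le (hρ.trans_le (norm_pole_le hk.le hs.le)))
    (summable_norm_mul_inv_pow_mul_pow _ hρ0.le hρ)) hzρ

lemma foldyOperator_singleArray (hk : 0 < k.im) (hs : 0 < X.s)
    (hX : (OmegaPlus k θI X ∩ OmegaMinus k X.s).Nonempty)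
    (h : IsKernelFactorization k X.a X.s Kp Km) (m : ℕ) :
    foldyOperator k X.a X.s (singleArray k θI X Kp Km) m = -incident k θI (X.pos m) := by
  have hpole := pole_mem_OmegaMinus hX
  obtain ⟨ρ, hρ, hρpole⟩ := exists_mem_Ioo_lt_norm_pole hk.le hs.le hX
  rw [foldyOperator_eq_upperToeplitz hk hs h hρ
    ((zTransformConverges_singleArray hk hs h).summable_norm
      ((Real.exp_pos _).trans hρ.1).le hρpole),
    singleArray_eq_lowerToeplitz, lowerToeplitz_lowerToeplitz, lowerToeplitz_comm (taylorCoeff Kp),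
    h.lowerToeplitz_lam_taylorCoeff hk hs, lowerToeplitz_single_zero_one, upperToeplitz,
    (hasSum_taylorCoeff_mul_geometric (h.differentiableOn_ball hk hs) _
      (norm_inv_lt_of_mem_OmegaMinus hpole) m).tsum_eq,
    incident_pos k θI X m, ← h.Km_eq hk hs hpole]
  have hKm := h.Km_ne_zero hk hs hpole
  field_simp

theorem isFoldySolution_singleArray (hk : 0 < k.im) (hs : 0 < X.s)
    (hX : (OmegaPlus k θI X ∩ OmegaMinus k X.s).Nonempty)
    (h : IsKernelFactorization k X.a X.s Kp Km) :
    IsFoldySolution k θI (fun _ : Fin 1 => X) (fun _ => singleArray k θI X Kp Km) := by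
  intro j m
  have hno_other : (Finset.univ : Finset (Fin 1)).erase j = ∅ :=
    Finset.eq_empty_of_forall_notMem fun i hi => Finset.ne_of_mem_erase hi (Subsingleton.elim i j)
  rw [hno_other, Finset.sum_empty, sub_zero]
  exact foldyOperator_singleArray hk hs hX h m

end SingleArray

section Interaction

variable {k : ℂ} {θI x₀ : ℝ} {X Y : SemiInfiniteArray} {Kp Km : ℂ → ℂ} {A : ℕ → ℂ}

lemma exists_norm_hankel_mul_ofReal_le (hk : 0 < k.im) (hx₀ : 0 < x₀) :
    ∃ C, 0 ≤ C ∧ ∀ x : ℝ, x₀ ≤ x → ‖hankel (k * x)‖ ≤ C * Real.exp (-(k.im * x)) := by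
  obtain ⟨C, hC, hH⟩ := exists_norm_hankel_le (mul_pos hk hx₀)
  refine ⟨C, hC, fun x hx => ?_⟩
  have him := im_mul_ofReal k x
  exact him ▸ hH (k * x) (him ▸ mul_le_mul_of_nonneg_left hx hk.le)

lemma summable_interactionTerm (hk : 0 < k.im) (hs : 0 < X.s)
    (h : IsKernelFactorization k X.a X.s Kp Km) (hx₀ : 0 < x₀)
    (hdist : ∀ m n, x₀ ≤ scattererDist X Y m n) (m q : ℕ) :
    Summable fun p : ℕ => interactionTerm k X Y Kp m q p := by
  obtain ⟨C, hC, hH⟩ := exists_norm_hankel_mul_ofReal_le hk hx₀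
  have hlam : Summable fun p => ‖lam Kp p‖ := by
    simpa using h.summable_lam hk hs zero_le_one (Real.one_lt_exp_iff.2 (mul_pos hk hs))
  refine summable_sum fun n _ => .of_norm_bounded
    ((hlam.mul_left ‖lam Kp (m - n)‖).mul_right C) fun p => ?_
  rw [norm_mul, norm_mul]
  refine mul_le_mul_of_nonneg_left ((hH _ (hdist _ _)).trans ?_) (by positivity)
  refine mul_le_of_le_one_right hC (Real.exp_le_one_iff.2 (neg_nonpos.2 ?_))
  exact mul_nonneg hk.le (hx₀.le.trans (hdist _ _))

/-- Weakening the decay rate by the factor `τ` slows down the growth in `p`, which comes from the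
possible approach of the arrays, at the expense of the decay in `q`. -/
lemma exists_norm_hankel_scattererDist_le (hk : 0 < k.im) (hXs : 0 ≤ X.s) (hYs : 0 ≤ Y.s)
    (hx₀ : 0 < x₀) (hdist : ∀ m n, x₀ ≤ scattererDist X Y m n) {τ : ℝ} (hτ : τ ∈ Icc 0 1)
    (n : ℕ) :
    ∃ C, ∀ p q, ‖hankel (k * scattererDist X Y (n + p) q)‖
      ≤ C * (Real.exp (-(τ * (k.im * Y.s))) ^ q * Real.exp (τ * (k.im * X.s)) ^ p) := by
  obtain ⟨C, hC, hH⟩ := exists_norm_hankel_mul_ofReal_le hk hx₀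
  let d : ℝ := n * X.s + dist (X.pos 0) (Y.pos 0)
  refine ⟨C * Real.exp (τ * k.im * d), fun p q => (hH _ (hdist _ _)).trans ?_⟩
  rw [mul_assoc C]
  refine mul_le_mul_of_nonneg_left ?_ hC
  rw [← Real.exp_nat_mul, ← Real.exp_nat_mul, ← Real.exp_add, ← Real.exp_add, Real.exp_le_exp]
  have hgrowth : q * Y.s - p * X.s - d ≤ scattererDist X Y (n + p) q := by
    have hle := le_scattererDist hXs hYs (n + p) q
    push_cast at hle
    linarith
  have hτk : 0 ≤ τ * k.im := mul_nonneg hτ.1 hk.le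
  have hweak : τ * (k.im * scattererDist X Y (n + p) q)
      ≤ k.im * scattererDist X Y (n + p) q :=
    mul_le_of_le_one_left (mul_nonneg hk.le (hx₀.le.trans (hdist _ _))) hτ.2
  linarith [mul_le_mul_of_nonneg_left hgrowth hτk]

/-- The contribution of the `q`-th scatterer of `Y`, transmitted by the `(n + p)`-th scatterer
of `X`, to the forcing of `X` after the upper triangular factor of its Foldy operator has been
inverted. The index `x` is `(q, p)`. -/
noncomputable def interactionSummand (k : ℂ) (X Y : SemiInfiniteArray) (Kp : ℂ → ℂ) (A : ℕ → ℂ)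
    (n : ℕ) (x : ℕ × ℕ) : ℂ :=
  lam Kp x.2 * (A x.1 * hankel (k * scattererDist X Y (n + x.2) x.1))

/-- The forcing of `X` by `Y` after the upper triangular factor of the Foldy operator of `X` has
been inverted. -/
noncomputable def interactionSum (k : ℂ) (X Y : SemiInfiniteArray) (Kp : ℂ → ℂ) (A : ℕ → ℂ)
    (n : ℕ) : ℂ :=
  ∑' x : ℕ × ℕ, interactionSummand k X Y Kp A n x

lemma summable_interactionSummand (hk : 0 < k.im) (hXs : 0 < X.s) (hYs : 0 < Y.s)
    (hY : (OmegaPlus k θI Y ∩ OmegaMinus k Y.s).Nonempty)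
    (h : IsKernelFactorization k X.a X.s Kp Km) (hx₀ : 0 < x₀)
    (hdist : ∀ m n, x₀ ≤ scattererDist X Y m n) (hA : ZTransformConverges k θI Y A) (n : ℕ) :
    Summable (interactionSummand k X Y Kp A n) := by
  obtain ⟨τ, hτ, hτ1⟩ := exists_between (max_lt zero_lt_one (cos_lt_one_of_nonempty hk hYs hY))
  obtain ⟨hτ0, hcosτ⟩ := max_lt_iff.1 hτ
  obtain ⟨C, hH⟩ :=
    exists_norm_hankel_scattererDist_le hk hXs.le hYs.le hx₀ hdist ⟨hτ0.le, hτ1.le⟩ n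
  have hlam := h.summable_lam hk hXs (Real.exp_pos (τ * (k.im * X.s))).le
    (Real.exp_lt_exp.2 (mul_lt_of_lt_one_left (mul_pos hk hXs) hτ1))
  have hAτ := hA.summable_norm (Real.exp_pos (-(τ * (k.im * Y.s)))).le (by
    rw [norm_pole, Real.exp_lt_exp, neg_lt_neg_iff, mul_comm τ]
    exact mul_lt_mul_of_pos_left hcosτ (mul_pos hk hYs))
  refine .of_norm_bounded ((hAτ.mul_of_nonneg hlam (fun _ => by positivity)
    (fun _ => by positivity)).mul_left C) fun x => ?_
  calc ‖interactionSummand k X Y Kp A n x‖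
      = ‖lam Kp x.2‖ * (‖A x.1‖ * ‖hankel (k * scattererDist X Y (n + x.2) x.1)‖) := by
        rw [interactionSummand, norm_mul, norm_mul]
    _ ≤ ‖lam Kp x.2‖ * (‖A x.1‖ * (C * (Real.exp (-(τ * (k.im * Y.s))) ^ x.1
          * Real.exp (τ * (k.im * X.s)) ^ x.2))) := by
        gcongr
        exact hH x.2 x.1
    _ = _ := by ring

lemma hasSum_lam_mul_tsum {n : ℕ} (hsum : Summable (interactionSummand k X Y Kp A n)) :
    HasSum (fun p => lam Kp p * ∑' q, A q * hankel (k * scattererDist X Y (n + p) q))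
      (interactionSum k X Y Kp A n) := by
  have hswap := (Equiv.prodComm ℕ ℕ).hasSum_iff.2 hsum.hasSum
  refine hswap.prod_fiberwise fun p => ?_
  rw [← tsum_mul_left]
  exact (hswap.summable.prod_factor p).hasSum

lemma interactionTerm_mul (m q p : ℕ) :
    interactionTerm k X Y Kp m q p * A q
      = lowerToeplitz (lam Kp) (fun n => interactionSummand k X Y Kp A n (q, p)) m := by
  rw [interactionTerm, lowerToeplitz, Finset.sum_mul]
  refine Finset.sum_congr rfl fun n _ => ?_
  rw [interactionSummand, add_comm n]
  ring

lemma hasSum_interactionTerm (hsum : ∀ n, Summable (interactionSummand k X Y Kp A n)) (m : ℕ) :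
    HasSum (fun x : ℕ × ℕ => interactionTerm k X Y Kp m x.1 x.2 * A x.1)
      (lowerToeplitz (lam Kp) (interactionSum k X Y Kp A) m) := by
  simp only [interactionTerm_mul]
  exact hasSum_sum fun n _ => (hsum n).hasSum.mul_left (lam Kp (m - n))

lemma hasSum_interactionMatrix (hsum : ∀ n, Summable (interactionSummand k X Y Kp A n)) (m : ℕ) :
    HasSum (fun q : ℕ => interactionMatrix k X Y Kp m q * A q)
      (lowerToeplitz (lam Kp) (interactionSum k X Y Kp A) m) := by
  have hterm := hasSum_interactionTerm hsum m
  refine hterm.prod_fiberwise fun q => ?_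
  rw [interactionMatrix, ← tsum_mul_right]
  exact (hterm.summable.prod_factor q).hasSum

lemma tsum_tsum_sum_lam_mul (hsum : ∀ n, Summable (interactionSummand k X Y Kp A n)) (m : ℕ) :
    ∑' q : ℕ, ∑' p : ℕ, ∑ n ∈ Finset.range (m + 1),
        lam Kp (m - n) * lam Kp p * A q * hankel (k * scattererDist X Y (p + n) q)
      = lowerToeplitz (lam Kp) (interactionSum k X Y Kp A) m := by
  have hterm := hasSum_interactionTerm hsum m
  rw [← hterm.tsum_eq, hterm.summable.tsum_prod]
  refine tsum_congr fun q => tsum_congr fun p => ?_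
  rw [interactionTerm, Finset.sum_mul]
  exact Finset.sum_congr rfl fun n _ => by ring

end Interaction

section CoupledSystems

variable {k : ℂ} {θI : ℝ} {J : ℕ} {X : Fin J → SemiInfiniteArray} {Kp Km : Fin J → ℂ → ℂ}
  {A : Fin J → ℕ → ℂ}

lemma Admissible.summable_interactionTerm (hk : 0 < k.im) (hadm : Admissible X)
    (h : ∀ j, IsKernelFactorization k (X j).a (X j).s (Kp j) (Km j)) {j l : Fin J} (hjl : j ≠ l)
    (m q : ℕ) : Summable fun p : ℕ => interactionTerm k (X j) (X l) (Kp j) m q p :=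
  FoldyArrays.summable_interactionTerm hk (hadm.spacing_pos j) (h j)
    (add_pos (hadm.radius_pos j) (hadm.radius_pos l))
    (fun m n => (hadm.other_array j l hjl m n).le) m q

lemma Admissible.summable_interactionSummand (hk : 0 < k.im) (hadm : Admissible X)
    (hX : ∀ j, (OmegaPlus k θI (X j) ∩ OmegaMinus k (X j).s).Nonempty)
    (h : ∀ j, IsKernelFactorization k (X j).a (X j).s (Kp j) (Km j))
    (hA : ∀ j, ZTransformConverges k θI (X j) (A j)) {j l : Fin J} (hjl : j ≠ l) (n : ℕ) :
    Summable (interactionSummand k (X j) (X l) (Kp j) (A l) n) :=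
  FoldyArrays.summable_interactionSummand hk (hadm.spacing_pos j) (hadm.spacing_pos l) (hX l)
    (h j) (add_pos (hadm.radius_pos j) (hadm.radius_pos l))
    (fun m n => (hadm.other_array j l hjl m n).le) (hA l) n

namespace IsFoldySolution

lemma foldyOperator_eq (hsol : IsFoldySolution k θI X A) (j : Fin J) (m : ℕ) :
    foldyOperator k (X j).a (X j).s (A j) m = -incident k θI ((X j).pos m)
      - ∑ l ∈ Finset.univ.erase j,
          ∑' n : ℕ, A l n * hankel (k * scattererDist (X j) (X l) m n) :=
  hsol j m

variable {j : Fin J}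

lemma upperToeplitz_lam_foldyOperator (hk : 0 < k.im) (hs : 0 < (X j).s)
    (hX : (OmegaPlus k θI (X j) ∩ OmegaMinus k (X j).s).Nonempty)
    (h : IsKernelFactorization k (X j).a (X j).s (Kp j) (Km j))
    (hsum : ∀ l, j ≠ l → ∀ n, Summable (interactionSummand k (X j) (X l) (Kp j) (A l) n))
    (hsol : IsFoldySolution k θI X A) (n : ℕ) :
    upperToeplitz (lam (Kp j)) (foldyOperator k (X j).a (X j).s (A j)) n
      = -(incident k θI ((X j).pos 0) / Km j (pole k θI (X j))) * (pole k θI (X j))⁻¹ ^ n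
        - ∑ l ∈ Finset.univ.erase j, interactionSum k (X j) (X l) (Kp j) (A l) n := by
  have hpole := pole_mem_OmegaMinus hX
  have hincident := hasSum_taylorCoeff_mul_geometric (h.differentiableOn_inv hk hs)
    (-incident k θI ((X j).pos 0)) (norm_inv_lt_of_mem_OmegaMinus hpole) n
  have hothers := hasSum_sum fun l (hl : l ∈ Finset.univ.erase j) =>
    hasSum_lam_mul_tsum (hsum l (Finset.ne_of_mem_erase hl).symm n)
  have htotal : HasSum
      (fun p => lam (Kp j) p * foldyOperator k (X j).a (X j).s (A j) (n + p)) _ :=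
    (hincident.sub hothers).congr_fun fun p => by
      rw [hsol.foldyOperator_eq, incident_pos, mul_sub, Finset.mul_sum, neg_mul,
        lam_eq_taylorCoeff]
  rw [upperToeplitz, htotal.tsum_eq, ← h.Km_eq hk hs hpole]
  ring

lemma eq_singleArray_sub_sum_lowerToeplitz (hk : 0 < k.im) (hs : 0 < (X j).s)
    (hX : (OmegaPlus k θI (X j) ∩ OmegaMinus k (X j).s).Nonempty)
    (h : IsKernelFactorization k (X j).a (X j).s (Kp j) (Km j))
    (hA : ZTransformConverges k θI (X j) (A j))
    (hsum : ∀ l, j ≠ l → ∀ n, Summable (interactionSummand k (X j) (X l) (Kp j) (A l) n))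
    (hsol : IsFoldySolution k θI X A) (m : ℕ) :
    A j m = singleArray k θI (X j) (Kp j) (Km j) m
      - ∑ l ∈ Finset.univ.erase j,
          lowerToeplitz (lam (Kp j)) (interactionSum k (X j) (X l) (Kp j) (A l)) m := by
  obtain ⟨ρ, hρ, hρpole⟩ := exists_mem_Ioo_lt_norm_pole hk.le hs.le hX
  have hinverse := eq_lowerToeplitz_upperToeplitz_foldyOperator hk hs h hρ
    (hA.summable_norm ((Real.exp_pos _).trans hρ.1).le hρpole)
  rw [congrFun hinverse m, funext (hsol.upperToeplitz_lam_foldyOperator hk hs hX h hsum),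
    lowerToeplitz_sub, lowerToeplitz_sum, ← singleArray_eq_lowerToeplitz]

theorem eq_singleArray_sub_sum_tsum_tsum (hk : 0 < k.im) (hs : 0 < (X j).s)
    (hX : (OmegaPlus k θI (X j) ∩ OmegaMinus k (X j).s).Nonempty)
    (h : IsKernelFactorization k (X j).a (X j).s (Kp j) (Km j))
    (hA : ZTransformConverges k θI (X j) (A j))
    (hsum : ∀ l, j ≠ l → ∀ n, Summable (interactionSummand k (X j) (X l) (Kp j) (A l) n))
    (hsol : IsFoldySolution k θI X A) (m : ℕ) :
    A j m = singleArray k θI (X j) (Kp j) (Km j) m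
      - ∑ l ∈ Finset.univ.erase j, ∑' q : ℕ, ∑' p : ℕ, ∑ n ∈ Finset.range (m + 1),
          lam (Kp j) (m - n) * lam (Kp j) p * A l q
            * hankel (k * scattererDist (X j) (X l) (p + n) q) := by
  rw [hsol.eq_singleArray_sub_sum_lowerToeplitz hk hs hX h hA hsum m]
  exact congrArg _ <| Finset.sum_congr rfl fun l hl =>
    (tsum_tsum_sum_lam_mul (hsum l (Finset.ne_of_mem_erase hl).symm) m).symm

theorem eq_singleArray_sub_sum_interactionMatrix (hk : 0 < k.im) (hs : 0 < (X j).s)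
    (hX : (OmegaPlus k θI (X j) ∩ OmegaMinus k (X j).s).Nonempty)
    (h : IsKernelFactorization k (X j).a (X j).s (Kp j) (Km j))
    (hA : ZTransformConverges k θI (X j) (A j))
    (hsum : ∀ l, j ≠ l → ∀ n, Summable (interactionSummand k (X j) (X l) (Kp j) (A l) n))
    (hsol : IsFoldySolution k θI X A) (m : ℕ) :
    A j m = singleArray k θI (X j) (Kp j) (Km j) m
      - ∑ l ∈ Finset.univ.erase j,
          ∑' q : ℕ, interactionMatrix k (X j) (X l) (Kp j) m q * A l q := by
  rw [hsol.eq_singleArray_sub_sum_lowerToeplitz hk hs hX h hA hsum m]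
  exact congrArg _ <| Finset.sum_congr rfl fun l hl =>
    (hasSum_interactionMatrix (hsum l (Finset.ne_of_mem_erase hl).symm) m).tsum_eq.symm

end IsFoldySolution

lemma hasSum_prod_of_fintype {ι κ M : Type*} [Fintype ι] [AddCommMonoid M] [TopologicalSpace M]
    [ContinuousAdd M] {f : ι × κ → M} {g : ι → M} (hf : ∀ i, HasSum (fun q => f (i, q)) (g i)) :
    HasSum f (∑ i, g i) := by
  classical
  have hrow (i : ι) : HasSum (fun v : ι × κ => if v.1 = i then f v else 0) (g i) := by
    refine ((Prod.mk_right_injective i).hasSum_iff fun v hv => if_neg fun hvi => ?_).1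
      ((hf i).congr_fun fun q => if_pos rfl)
    exact hv ⟨v.2, Prod.ext hvi.symm rfl⟩
  exact (hasSum_sum fun i _ => hrow i).congr_fun fun v => by simp

lemma hasSum_blockMatrix_diagonal (k : ℂ) (X : Fin J → SemiInfiniteArray) (Kp : Fin J → ℂ → ℂ)
    (A : ℕ → ℂ) (j : Fin J) (m : ℕ) :
    HasSum (fun q => blockMatrix k X Kp (j, m) (j, q) * A q) (A m) := by
  refine (hasSum_ite_eq m (A m)).congr_fun fun q => ?_
  rw [blockMatrix, if_pos rfl, Matrix.one_apply]
  by_cases hqm : q = m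
  · rw [if_pos hqm.symm, if_pos hqm, one_mul, hqm]
  · rw [if_neg (Ne.symm hqm), if_neg hqm, zero_mul]

theorem IsFoldySolution.hasSum_blockMatrix {j : Fin J} (hk : 0 < k.im) (hs : 0 < (X j).s)
    (hX : (OmegaPlus k θI (X j) ∩ OmegaMinus k (X j).s).Nonempty)
    (h : IsKernelFactorization k (X j).a (X j).s (Kp j) (Km j))
    (hA : ZTransformConverges k θI (X j) (A j))
    (hsum : ∀ l, j ≠ l → ∀ n, Summable (interactionSummand k (X j) (X l) (Kp j) (A l) n))
    (hsol : IsFoldySolution k θI X A) (m : ℕ) :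
    HasSum (fun v : Fin J × ℕ => blockMatrix k X Kp (j, m) v * A v.1 v.2)
      (singleArray k θI (X j) (Kp j) (Km j) m) := by
  set rowSum : Fin J → ℂ := fun l => if l = j then A j m
    else lowerToeplitz (lam (Kp j)) (interactionSum k (X j) (X l) (Kp j) (A l)) m with hrowSum
  have hrow (l : Fin J) :
      HasSum (fun q => blockMatrix k X Kp (j, m) (l, q) * A l q) (rowSum l) := by
    by_cases hlj : l = j
    · subst hlj
      simpa only [hrowSum, if_true] using hasSum_blockMatrix_diagonal k X Kp (A l) l m
    · simpa only [hrowSum, if_neg hlj, blockMatrix, if_neg (Ne.symm hlj)] using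
        hasSum_interactionMatrix (hsum l (Ne.symm hlj)) m
  have htotal : ∑ l, rowSum l = singleArray k θI (X j) (Kp j) (Km j) m := by
    rw [← Finset.add_sum_erase _ _ (Finset.mem_univ j), Finset.sum_congr rfl fun l hl =>
      if_neg (Finset.ne_of_mem_erase hl), hrowSum]
    dsimp only
    rw [if_pos rfl, hsol.eq_singleArray_sub_sum_lowerToeplitz hk hs hX h hA hsum m,
      sub_add_cancel]
  exact htotal ▸ hasSum_prod_of_fintype hrow

end CoupledSystems

end FoldyArrays

theorem mainTheorem1 (k : ℂ) (hk : 0 < k.im) :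
    -- the kernel is zero-free for small scatterers
    (∀ s : ℝ, 0 < s → ∃ ε : ℝ, 0 < ε ∧ ∀ a : ℝ, 0 < a → a < ε →
      FoldyArrays.KernelZeroFree k a s) ∧
    -- factorization of a zero-free kernel
    (∀ a s : ℝ, 0 < a → 0 < s → FoldyArrays.KernelZeroFree k a s →
      (∃ Kp Km : ℂ → ℂ, FoldyArrays.IsKernelFactorization k a s Kp Km) ∧
      ∀ Kp Km : ℂ → ℂ, FoldyArrays.IsKernelFactorization k a s Kp Km →
        DifferentiableOn ℂ Kp {z | ‖z‖ < Real.exp (k.im * s)} ∧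
        (∀ z : ℂ, ‖z‖ < Real.exp (k.im * s) → Kp z ≠ 0) ∧
        DifferentiableOn ℂ Km (FoldyArrays.OmegaMinus k s) ∧
        (∀ z ∈ FoldyArrays.OmegaMinus k s, Km z ≠ 0) ∧
        (∀ z : ℂ, z ≠ 0 → ‖z‖ < Real.exp (k.im * s) → Km z⁻¹ = Kp z) ∧
        (∀ z ∈ FoldyArrays.kernelAnnulus k s, FoldyArrays.kernel k a s z = Kp z * Km z)) ∧
    -- the Wiener–Hopf solution of the coupled systems
    (∀ (J : ℕ) (X : Fin J → FoldyArrays.SemiInfiniteArray) (θI : ℝ),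
      FoldyArrays.Admissible X →
      (∀ j, (FoldyArrays.OmegaPlus k θI (X j) ∩ FoldyArrays.OmegaMinus k (X j).s).Nonempty) →
      (∀ j, FoldyArrays.KernelZeroFree k (X j).a (X j).s) →
      ∀ Kp Km : Fin J → ℂ → ℂ,
      (∀ j, FoldyArrays.IsKernelFactorization k (X j).a (X j).s (Kp j) (Km j)) →
      -- `A₀` solves the system of each array alone
      (∀ j,
        FoldyArrays.ZTransformConverges k θI (X j)
          (FoldyArrays.singleArray k θI (X j) (Kp j) (Km j)) ∧
        FoldyArrays.IsFoldySolution k θI (fun _ : Fin 1 => X j)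
          (fun _ => FoldyArrays.singleArray k θI (X j) (Kp j) (Km j))) ∧
      -- the series defining the interaction matrices converge absolutely
      (∀ j l, j ≠ l → ∀ m q : ℕ,
        Summable fun p : ℕ => FoldyArrays.interactionTerm k (X j) (X l) (Kp j) m q p) ∧
      ∀ A : Fin J → ℕ → ℂ,
        (∀ j, FoldyArrays.ZTransformConverges k θI (X j) (A j)) →
        FoldyArrays.IsFoldySolution k θI X A →
        (∀ j l, j ≠ l → ∀ m : ℕ, Summable fun x : ℕ × ℕ =>
          FoldyArrays.interactionTerm k (X j) (X l) (Kp j) m x.1 x.2 * A l x.1) ∧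
        (∀ j l, j ≠ l → ∀ m : ℕ, Summable fun q : ℕ =>
          FoldyArrays.interactionMatrix k (X j) (X l) (Kp j) m q * A l q) ∧
        (∀ j, ∀ m : ℕ, A j m = FoldyArrays.singleArray k θI (X j) (Kp j) (Km j) m
          - ∑ l ∈ Finset.univ.erase j, ∑' q : ℕ, ∑' p : ℕ, ∑ n ∈ Finset.range (m + 1),
              FoldyArrays.lam (Kp j) (m - n) * FoldyArrays.lam (Kp j) p * A l q
                * FoldyArrays.hankel
                    (k * FoldyArrays.scattererDist (X j) (X l) (p + n) q)) ∧
        (∀ j, ∀ m : ℕ, A j m = FoldyArrays.singleArray k θI (X j) (Kp j) (Km j) m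
          - ∑ l ∈ Finset.univ.erase j,
              ∑' q : ℕ, FoldyArrays.interactionMatrix k (X j) (X l) (Kp j) m q * A l q) ∧
        (∀ j, ∀ m : ℕ, HasSum
          (fun v : Fin J × ℕ => FoldyArrays.blockMatrix k X Kp (j, m) v * A v.1 v.2)
          (FoldyArrays.singleArray k θI (X j) (Kp j) (Km j) m))) := by
  refine ⟨fun s hs => FoldyArrays.kernelZeroFree_of_small hk hs, fun a s _ hs hK =>
    ⟨FoldyArrays.exists_isKernelFactorization hk hs hK, fun Kp Km h =>
      ⟨h.differentiableOn_Kp hk hs, fun z hz => h.Kp_ne_zero hk hs hz, h.differentiableOn_Km hk hs,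
        fun z hz => h.Km_ne_zero hk hs hz, fun z hz₀ hz => h.Km_inv hk hs hz₀ hz,
        fun z hz => h.kernel_eq_mul hz⟩⟩, ?_⟩
  intro J X θI hadm hX _ Kp Km h
  have hs := hadm.spacing_pos
  refine ⟨fun j => ⟨FoldyArrays.zTransformConverges_singleArray hk (hs j) (h j),
    FoldyArrays.isFoldySolution_singleArray hk (hs j) (hX j) (h j)⟩,
    fun j l hjl => hadm.summable_interactionTerm hk h hjl, fun A hA hsol => ?_⟩
  have hsum := fun (j l : Fin J) (hjl : j ≠ l) => hadm.summable_interactionSummand hk hX h hA hjl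
  exact ⟨fun j l hjl m => (FoldyArrays.hasSum_interactionTerm (hsum j l hjl) m).summable,
    fun j l hjl m => (FoldyArrays.hasSum_interactionMatrix (hsum j l hjl) m).summable,
    fun j => hsol.eq_singleArray_sub_sum_tsum_tsum hk (hs j) (hX j) (h j) (hA j) (hsum j),
    fun j => hsol.eq_singleArray_sub_sum_interactionMatrix hk (hs j) (hX j) (h j) (hA j) (hsum j),
    fun j => hsol.hasSum_blockMatrix hk (hs j) (hX j) (h j) (hA j) (hsum j)⟩
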